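/- **Theorem 1.2 (Inverse scattering).** Let $\mathcal H=\ell^2(\mathbb Z;\mathbb C^2)$, let $e_1,e_2$ be the standard basis of $\mathbb C^2$, and let $\delta_{j,0}\in\mathcal H$ be the state equal to $e_j$ at $x=0$ and to $0$ elsewhere. The inner product $\langle\cdot,\cdot\rangle$ is linear in the first argument, and matrices carry the operator norm $\|\cdot\|_{\mathbb C^2\to\mathbb C^2}$. Let $$C_0=\begin{pmatrix} a & b\\ -\bar b & \bar a\end{pmatrix}\in U(2),\qquad 0<|a|<1,$$ and let $C_N(s_1,s_2)=\tilde C_N(s_1^2,s_2^2)$ for $s_1,s_2\ge 0$, where $\tilde C_N\in C^2(\mathbb R^2;U(2))$ satisfies, for some constant $K$, $$\|\tilde C_N(s_1,s_2)-I_2\|_{\mathbb C^2\to\mathbb C^2}\le K(|s_1|+|s_2|)\qquad (s_1,s_2\in\mathbb R).$$ Let $(Su)(x)=(u_1(x+1),u_2(x-1))$, let $(U_0u)(x)=(S(C_0u))(x)$, and let $U=S\hat C$ with $(\hat Cu)(x)=C_0C_N(|u_1(x)|^2,|u_2(x)|^2)\,u(x)$; write $U(t)=U^t$ for $t=0,1,2,\dots$.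 Then there is $\delta>0$ such that for every $u_0$ with $\|u_0\|_{\ell^1}=\sum_x\|u_0(x)\|_{\mathbb C^2}<\delta$ there is a unique $u_+\in\mathcal H$ with $\|U(t)u_0-U_0^tu_+\|_{\ell^2}\to0$ as $t\to\infty$; put $W^*u_0:=u_+$. For small $\lambda>0$ and $j=1,2$ set $$\mathcal L_{1j}(\lambda)=\lambda^{-10}\big\langle (W^*-U_0^{-1}W^*U_0)(\lambda^2\delta_{1,0}+\lambda^3\delta_{2,0}),\delta_{j,0}\big\rangle,$$ $$\mathcal L_{2j}(\lambda)=\lambda^{-10}\big\langle (W^*-U_0^{-1}W^*U_0)(\lambda^3\delta_{1,0}+\lambda^2\delta_{2,0}),\delta_{j,0}\big\rangle,$$ and $D_\lambda g(\lambda)=\lambda^{-1}(g(2\lambda)-g(\lambda))$. Then there are constants $C$ and $\lambda_0>0$ such that for all $0<\lambda<\lambda_0$ $$\left\|\begin{pmatrix} \mathcal L_{11}(\lambda)-\lambda D_\lambda\mathcal L_{11}(\lambda) & D_\lambda\mathcal L_{11}(\lambda)\\ \mathcal L_{12}(\lambda)-\lambda D_\lambda\mathcal L_{12}(\lambda) &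 D_\lambda\mathcal L_{12}(\lambda)\end{pmatrix}-\partial_1\tilde C_N(0,0)\right\|_{\mathbb C^2\to\mathbb C^2}\le C\lambda^3,$$ $$\left\|\begin{pmatrix} D_\lambda\mathcal L_{21}(\lambda) & \mathcal L_{21}(\lambda)-\lambda D_\lambda\mathcal L_{21}(\lambda)\\ D_\lambda\mathcal L_{22}(\lambda) & \mathcal L_{22}(\lambda)-\lambda D_\lambda\mathcal L_{22}(\lambda)\end{pmatrix}-\partial_2\tilde C_N(0,0)\right\|_{\mathbb C^2\to\mathbb C^2}\le C\lambda^3.$$ -/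

import Mathlib

open Filter Topology
open scoped ComplexConjugate Matrix.Norms.L2Operator

noncomputable section

namespace NLQW

/-- The spin space `ℂ²` with its Euclidean norm. -/
abbrev Spin : Type := EuclideanSpace ℂ (Fin 2)

/-- The group `U(2)` of unitary `2 × 2` matrices. -/
abbrev U2 : Type := ↥(Matrix.unitaryGroup (Fin 2) ℂ)

/-- The state space `l²(ℤ; ℂ²)`. -/
abbrev State : Type := ↥(lp (fun _ : ℤ => Spin) 2)

/-- The matrix-vector product `A v` on `ℂ²`. -/
def act (A : U2) (v : Spin) : Spin :=
  WithLp.toLp 2 (Matrix.mulVec (A : Matrix (Fin 2) (Fin 2) ℂ) (WithLp.ofLp v))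

theorem norm_act (A : U2) (v : Spin) : ‖act A v‖ = ‖v‖ := by
  have hA : star (A : Matrix (Fin 2) (Fin 2) ℂ) * (A : Matrix (Fin 2) (Fin 2) ℂ) = 1 :=
    Matrix.UnitaryGroup.star_mul_self A
  have key : inner ℂ (act A v) (act A v) = inner ℂ v v := by
    rw [EuclideanSpace.inner_eq_star_dotProduct, EuclideanSpace.inner_eq_star_dotProduct]
    simp only [act]
    rw [Matrix.star_mulVec, dotProduct_comm, ← Matrix.dotProduct_mulVec, Matrix.mulVec_mulVec,
      ← Matrix.star_eq_conjTranspose, hA, Matrix.one_mulVec, dotProduct_comm]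
  rw [inner_self_eq_norm_sq_to_K, inner_self_eq_norm_sq_to_K] at key
  have h2 : ‖act A v‖ ^ 2 = ‖v‖ ^ 2 := by exact_mod_cast key
  exact (sq_eq_sq₀ (norm_nonneg _) (norm_nonneg _)).1 h2

theorem act_add (A : U2) (v w : Spin) : act A (v + w) = act A v + act A w := by
  simp only [act, WithLp.ofLp_add, Matrix.mulVec_add, WithLp.toLp_add]

theorem act_smul (A : U2) (c : ℂ) (v : Spin) : act A (c • v) = c • act A v := by
  simp only [act, WithLp.ofLp_smul, Matrix.mulVec_smul, WithLp.toLp_smul]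

theorem act_mul (A B : U2) (v : Spin) : act (A * B) v = act A (act B v) := by
  simp only [act, Matrix.mulVec_mulVec]; rfl

theorem act_one (v : Spin) : act 1 v = v := by
  simp [act]

theorem memlp_congr_norm {f g : ℤ → Spin} (h : ∀ x, ‖f x‖ = ‖g x‖) (hg : Memℓp g 2) :
    Memℓp f 2 := by
  rw [memℓp_gen_iff (by norm_num)] at hg ⊢
  simpa only [h] using hg

/-- The quantum coin `(Ĉ u)(x) = C(|u₁(x)|², |u₂(x)|²) u(x)` on `l²(ℤ; ℂ²)`. -/
def coinOp (C : ℝ → ℝ → U2) (u : State) : State :=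
  ⟨fun x => act (C (‖u x 0‖ ^ 2) (‖u x 1‖ ^ 2)) (u x),
    memlp_congr_norm (fun _ => norm_act _ _) (lp.memℓp u)⟩

theorem norm_eq_of_norm_eq {u v : State} (h : ∀ x, ‖u x‖ = ‖v x‖) : ‖u‖ = ‖v‖ := by
  rw [lp.norm_eq_tsum_rpow (by norm_num), lp.norm_eq_tsum_rpow (by norm_num)]
  simp only [h]

/-- The constant coin `(Ĉ₀ u)(x) = C₀ u(x)`, as a unitary operator of `l²(ℤ; ℂ²)`. -/
def constCoin (A : U2) : State ≃ₗᵢ[ℂ] State where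
  toFun := coinOp fun _ _ => A
  map_add' u v := by ext1; funext x; exact act_add A (u x) (v x)
  map_smul' c u := by ext1; funext x; exact act_smul A c (u x)
  invFun := coinOp fun _ _ => A⁻¹
  left_inv u := by
    ext1; funext x
    change act A⁻¹ (act A (u x)) = u x
    rw [← act_mul, inv_mul_cancel, act_one]
  right_inv u := by
    ext1; funext x
    change act A (act A⁻¹ (u x)) = u x
    rw [← act_mul, mul_inv_cancel, act_one]
  norm_map' u := norm_eq_of_norm_eq fun x => norm_act A (u x)

/-- `shiftFun k u x = (u₁(x + k), u₂(x - k))`. -/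
def shiftFun (k : ℤ) (u : ℤ → Spin) (x : ℤ) : Spin := !₂[u (x + k) 0, u (x - k) 1]

theorem summable_coord {u : ℤ → Spin} (hu : Memℓp u 2) (i : Fin 2) :
    Summable fun x => ‖u x i‖ ^ 2 := by
  have h := (memℓp_gen_iff (p := 2) (by norm_num)).1 hu
  refine Summable.of_nonneg_of_le (fun _ => by positivity) (fun x => ?_) h
  have := PiLp.norm_apply_le (u x) i
  simpa using pow_le_pow_left₀ (norm_nonneg _) this 2

theorem norm_sq_spin (v : Spin) : ‖v‖ ^ 2 = ‖v 0‖ ^ 2 + ‖v 1‖ ^ 2 := by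
  rw [EuclideanSpace.norm_sq_eq, Fin.sum_univ_two]

theorem norm_sq_shiftFun (k : ℤ) (u : ℤ → Spin) (x : ℤ) :
    ‖shiftFun k u x‖ ^ 2 = ‖u (x + k) 0‖ ^ 2 + ‖u (x - k) 1‖ ^ 2 := by
  rw [norm_sq_spin]; simp [shiftFun]

theorem memlp_shiftFun (k : ℤ) {u : ℤ → Spin} (hu : Memℓp u 2) : Memℓp (shiftFun k u) 2 := by
  rw [memℓp_gen_iff (by norm_num)]
  have h0 := (Equiv.addRight k).summable_iff.2 (summable_coord hu 0)
  have h1 := (Equiv.subRight k).summable_iff.2 (summable_coord hu 1)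
  refine (h0.add h1).congr fun x => ?_
  simpa using (norm_sq_shiftFun k u x).symm

theorem norm_sq_state (u : State) :
    ‖u‖ ^ 2 = (∑' x, ‖u x 0‖ ^ 2) + ∑' x, ‖u x 1‖ ^ 2 := by
  have h := lp.norm_rpow_eq_tsum (p := 2) (by norm_num) u
  rw [← (summable_coord (lp.memℓp u) 0).tsum_add (summable_coord (lp.memℓp u) 1)]
  simp only [← norm_sq_spin]
  simpa using h

/-- The shift `S = diag(T₋, T₊)`, that is `(S u)(x) = (u₁(x + 1), u₂(x - 1))`, as a unitary
operator of `l²(ℤ; ℂ²)`. -/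
def shift : State ≃ₗᵢ[ℂ] State where
  toFun u := ⟨shiftFun 1 u, memlp_shiftFun 1 (lp.memℓp u)⟩
  map_add' u v := by
    ext1; funext x; change shiftFun 1 _ x = shiftFun 1 _ x + shiftFun 1 _ x
    ext i; fin_cases i <;> simp [shiftFun]
  map_smul' c u := by
    ext1; funext x; change shiftFun 1 _ x = c • shiftFun 1 _ x
    ext i; fin_cases i <;> simp [shiftFun]
  invFun u := ⟨shiftFun (-1) u, memlp_shiftFun (-1) (lp.memℓp u)⟩
  left_inv u := by
    ext1; funext x; change shiftFun (-1) (shiftFun 1 u) x = u x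
    ext i; fin_cases i <;> simp [shiftFun]
  right_inv u := by
    ext1; funext x; change shiftFun 1 (shiftFun (-1) u) x = u x
    ext i; fin_cases i <;> simp [shiftFun]
  norm_map' u := by
    refine (sq_eq_sq₀ (norm_nonneg _) (norm_nonneg _)).1 ?_
    rw [norm_sq_state, norm_sq_state]
    congr 1
    · exact (Equiv.addRight (1 : ℤ)).tsum_eq fun x => ‖u x 0‖ ^ 2
    · exact (Equiv.subRight (1 : ℤ)).tsum_eq fun x => ‖u x 1‖ ^ 2

/-- One step `U = S Ĉ` of the nonlinear quantum walk with coin `C`. -/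
def step (C : ℝ → ℝ → U2) (u : State) : State := shift (coinOp C u)

/-- The nonlinear evolution `U(t) u₀`: `u(0) = u₀`, `u(t) = U u(t - 1)`. -/
def evolution (C : ℝ → ℝ → U2) (t : ℕ) (u₀ : State) : State := (step C)^[t] u₀

/-- The linear walk `U₀ = S Ĉ₀`, a unitary operator. -/
def linearWalk (C₀ : U2) : State ≃ₗᵢ[ℂ] State := (constCoin C₀).trans shift

/-- `u₊` is the final (scattering) data of `U(t) u₀`: `‖U(t) u₀ - U₀ᵗ u₊‖ → 0` as `t → ∞`, where
`U(t)` has the coin `C₀ C_N` and `U₀ = S Ĉ₀`. -/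
def IsFinalData (C₀ : U2) (CN : ℝ → ℝ → U2) (u₀ uplus : State) : Prop :=
  Tendsto (fun t : ℕ =>
    ‖evolution (fun s₁ s₂ => C₀ * CN s₁ s₂) t u₀ - (linearWalk C₀ ^ t) uplus‖) atTop (𝓝 0)

open Classical in
/-- The nonlinear scattering operator `W*`, sending `u₀` to its final data `u₊`
(and, by convention, to `0` if `U(t) u₀` does not scatter). -/
def Wstar (C₀ : U2) (CN : ℝ → ℝ → U2) (u₀ : State) : State :=
  if h : ∃ uplus, IsFinalData C₀ CN u₀ uplus then h.choose else 0

/-- The state `δ_{j,0}` (`j = 0, 1` stands for the first and second basis vector of `ℂ²`). -/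
def delta (j : Fin 2) : State := lp.single 2 (0 : ℤ) (EuclideanSpace.single j (1 : ℂ))

/-- `μ⁻¹⁰ ⟨(W* - U₀⁻¹ W* U₀) φ, δ_{j,0}⟩`; the inner product of the formula is linear in its first
argument, Mathlib's in its second. -/
def scatCoeff (C₀ : U2) (CN : ℝ → ℝ → U2) (j : Fin 2) (μ : ℝ) (φ : State) : ℂ :=
  ((μ : ℂ) ^ 10)⁻¹ *
    inner ℂ (delta j)
      (Wstar C₀ CN φ - (linearWalk C₀).symm (Wstar C₀ CN (linearWalk C₀ φ)))

/-- `𝓛_{1j}(μ)`, from the state `μ² δ_{1,0} + μ³ δ_{2,0}`. -/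
def L1 (C₀ : U2) (CN : ℝ → ℝ → U2) (j : Fin 2) (μ : ℝ) : ℂ :=
  scatCoeff C₀ CN j μ ((μ : ℂ) ^ 2 • delta 0 + (μ : ℂ) ^ 3 • delta 1)

/-- `𝓛_{2j}(μ)`, from the state `μ³ δ_{1,0} + μ² δ_{2,0}`. -/
def L2 (C₀ : U2) (CN : ℝ → ℝ → U2) (j : Fin 2) (μ : ℝ) : ℂ :=
  scatCoeff C₀ CN j μ ((μ : ℂ) ^ 3 • delta 0 + (μ : ℂ) ^ 2 • delta 1)

/-- The difference quotient `D_λ g(λ) = λ⁻¹ (g(2λ) - g(λ))`. -/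
def diffQuot (g : ℝ → ℂ) (μ : ℝ) : ℂ := (μ : ℂ)⁻¹ * (g (2 * μ) - g μ)

end NLQW

end

noncomputable section

namespace NLQW

/-! The coin differs from `C₀` by terms of order `|u|⁴`, so the nonlinear part `N(u) = Ĉ_N u - u` is
quintic: its `ℓ¹` norm is at most `K` times the fifth power of the `ℓ⁵` norm of `u`. Small data
therefore scatter as soon as the linear walk maps `ℓ¹` data into `ℓ⁵` of space-time, and this
estimate is the analytic core.

For the linear estimate, Cayley-Hamilton for `U₀` in Fourier space (determinant one, trace `a e^{ik}
+ ā e^{-ik}`) reduces powers of `U₀` to a scalar kernel, the Fourier coefficients of Chebyshev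
polynomials at `|a| cos k`. Removing the phase of `a` and folding the integral leaves `halfKernel`.
Its phase has an inflection point only at `s = 0`, which is responsible for the caustic `x = ±|a|
t`. Van der Corput arguments give `|kernel|⁴ ≤ C / (t (1 + ||a| t - x|))`
(`exists_norm_halfKernel_le`). To the power `5/4` this is summable in `x` and then in `t`.
Minkowski's inequality and Duhamel's formula turn this into `exists_spacetime_bound`, and a
bootstrap (`sum_nonlinearity_le`) controls the nonlinear flow.

For the inverse problem, `U(t+1)φ` is compared with `U(t)U₀φ`. Their difference starts from `U₀
N(φ)`, of size `σ⁵` when `φ` has size `σ`, and it evolves almost linearly, so `(W* - U₀⁻¹ W* U₀) φ =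
N(φ) + O(σ⁹)` (`norm_Wstar_commutator_sub_le`). On states at the origin `N(φ)` is explicit. With
components `λ²` and `λ³` the arguments of the coin are `λ⁸` and `λ¹²`, so one partial derivative
dominates and `λ⁻¹⁰ N(φ)` is `p + λ q + O(λ⁴)`, with `p, q` the entries of a row of that derivative.
The commutator error `λ¹⁸` is absorbed. Sampling at `λ` and `2λ` separates `p` from `q` and loses
one power of `λ` (`norm_diffQuot_sub_le`). -/

/-! ### Oscillatory integrals: van der Corput tests. -/

/-- First derivative test for oscillatory integrals with monotone phase velocity and monotone
amplitude. -/
theorem norm_oscillatory_le_of_le_abs_deriv {φ ψ ψ' g g' : ℝ → ℝ} {α β μ G : ℝ} (hαβ : α ≤ β)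
    (hμ : 0 < μ)
    (hφ : ∀ s, HasDerivAt φ (ψ s) s) (hψ : ∀ s, HasDerivAt ψ (ψ' s) s)
    (hg : ∀ s, HasDerivAt g (g' s) s) (hψ'c : Continuous ψ') (hg'c : Continuous g')
    (hψ' : ∀ s ∈ Set.Icc α β, ψ' s ≤ 0) (hg' : ∀ s ∈ Set.Icc α β, 0 ≤ g' s)
    (hg0 : ∀ s, 0 ≤ g s) (hG : ∀ s, g s ≤ G) (hψμ : ∀ s ∈ Set.Icc α β, μ ≤ |ψ s|) :
    ‖∫ s in α..β, Complex.exp (Complex.I * φ s) * g s‖ ≤ 5 * G / μ := by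
  have hu := Set.uIcc_of_le hαβ
  have hG0 : 0 ≤ G := (hg0 0).trans (hG 0)
  have hne : ∀ s ∈ Set.Icc α β, ψ s ≠ 0 := fun s hs h0 => by
    have := hψμ s hs; rw [h0, abs_zero] at this; linarith
  have hψc : Continuous ψ := continuous_iff_continuousAt.2 fun s => (hψ s).continuousAt
  have hgc : Continuous g := continuous_iff_continuousAt.2 fun s => (hg s).continuousAt
  have hφc : Continuous φ := continuous_iff_continuousAt.2 fun s => (hφ s).continuousAt
  set w' : ℝ → ℝ := fun s => (g' s * ψ s - g s * ψ' s) / ψ s ^ 2 with hw'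
  have hw : ∀ s ∈ Set.Icc α β, HasDerivAt (fun s => g s / ψ s) (w' s) s := fun s hs =>
    (hg s).div (hψ s) (hne s hs)
  have hw'c : ContinuousOn w' (Set.Icc α β) := by
    refine ContinuousOn.div (by fun_prop) (by fun_prop) fun s hs => pow_ne_zero 2 (hne s hs)
  have hv : ∀ s, HasDerivAt (fun s => -Complex.I * Complex.exp (Complex.I * φ s))
      (ψ s * Complex.exp (Complex.I * φ s)) s := fun s => by
    have := (((hφ s).ofReal_comp).const_mul Complex.I).cexp.const_mul (-Complex.I)
    refine this.congr_deriv ?_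
    linear_combination (-(Complex.exp (Complex.I * φ s)) * ψ s) * Complex.I_mul_I
  have hnorm : ∀ s, ‖-Complex.I * Complex.exp (Complex.I * φ s)‖ = 1 := fun s => by
    rw [norm_mul, mul_comm Complex.I, Complex.norm_exp_ofReal_mul_I]; simp
  -- Integration by parts against `ψ e^{iφ}`, the derivative of `-i e^{iφ}`. The two boundary terms
  -- cost `G / μ` each, the remaining integral `3 G / μ`.
  have ibp := intervalIntegral.integral_mul_deriv_eq_deriv_mul (a := α) (b := β)
    (u := fun s => ((g s / ψ s : ℝ) : ℂ)) (u' := fun s => ((w' s : ℝ) : ℂ))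
    (fun s hs => (hw s (hu ▸ hs)).ofReal_comp) (fun s _ => hv s)
    ((Complex.continuous_ofReal.comp_continuousOn (hu.symm ▸ hw'c)).intervalIntegrable)
    ((by fun_prop : Continuous fun s => (ψ s : ℂ) * Complex.exp (Complex.I * φ s)).intervalIntegrable
      _ _)
  have hE : ∫ s in α..β, Complex.exp (Complex.I * φ s) * g s
      = ∫ s in α..β, ((g s / ψ s : ℝ) : ℂ) * (ψ s * Complex.exp (Complex.I * φ s)) := by
    refine intervalIntegral.integral_congr fun s hs => ?_
    have : (ψ s : ℂ) ≠ 0 := by exact_mod_cast hne s (hu ▸ hs)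
    push_cast
    field_simp
  rw [hE, ibp]
  have hb : ∀ s ∈ Set.Icc α β,
      ‖((g s / ψ s : ℝ) : ℂ) * (-Complex.I * Complex.exp (Complex.I * φ s))‖ ≤ G / μ := by
    intro s hs
    rw [norm_mul, hnorm, mul_one, Complex.norm_real, Real.norm_eq_abs, abs_div, abs_of_nonneg (hg0 s)]
    exact div_le_div₀ hG0 (hG s) hμ (hψμ s hs)
  -- By monotonicity of `g` and `ψ`, `|(g / ψ)'|` is dominated by the derivative of `g / μ + G / ψ`,
  -- so its integral is a difference of boundary values.
  have hd : ∀ s ∈ Set.Icc α β, HasDerivAt (fun s => g s / μ + G * (ψ s)⁻¹)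
      (g' s / μ + G * (-ψ' s / ψ s ^ 2)) s := fun s hs =>
    ((hg s).div_const μ).add (((hψ s).inv (hne s hs)).const_mul G)
  have hdc : ContinuousOn (fun s => g' s / μ + G * (-ψ' s / ψ s ^ 2)) (Set.Icc α β) := by
    refine ContinuousOn.add (by fun_prop) (continuousOn_const.mul ?_)
    exact ContinuousOn.div (by fun_prop) (by fun_prop) fun s hs => pow_ne_zero 2 (hne s hs)
  have hInt : ‖∫ s in α..β, ((w' s : ℝ) : ℂ) * (-Complex.I * Complex.exp (Complex.I * φ s))‖
      ≤ 3 * G / μ := by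
    have h1 : ‖∫ s in α..β, ((w' s : ℝ) : ℂ) * (-Complex.I * Complex.exp (Complex.I * φ s))‖
        ≤ ∫ s in α..β, (g' s / μ + G * (-ψ' s / ψ s ^ 2)) := by
      refine intervalIntegral.norm_integral_le_of_norm_le hαβ (MeasureTheory.ae_of_all _ fun s hs => ?_)
        (hu.symm ▸ hdc).intervalIntegrable
      have hs' := Set.Ioc_subset_Icc_self hs
      rw [norm_mul, hnorm, mul_one, Complex.norm_real, Real.norm_eq_abs, hw']
      have hψ0 : 0 < |ψ s| := hμ.trans_le (hψμ s hs')
      have e : (g' s * ψ s - g s * ψ' s) / ψ s ^ 2 = g' s / ψ s + g s * (-ψ' s / ψ s ^ 2) := by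
        have := hne s hs'
        field_simp
        ring
      have h2 : 0 ≤ -ψ' s / ψ s ^ 2 := div_nonneg (neg_nonneg.2 (hψ' s hs')) (sq_nonneg _)
      change |(g' s * ψ s - g s * ψ' s) / ψ s ^ 2| ≤ _
      rw [e]
      refine (abs_add_le _ _).trans (add_le_add ?_ ?_)
      · rw [abs_div, abs_of_nonneg (hg' s hs')]
        exact div_le_div_of_nonneg_left (hg' s hs') hμ (hψμ s hs')
      · rw [abs_mul, abs_of_nonneg (hg0 s), abs_of_nonneg h2]
        exact mul_le_mul_of_nonneg_right (hG s) h2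
    refine h1.trans ?_
    rw [intervalIntegral.integral_eq_sub_of_hasDerivAt (fun s hs => hd s (hu ▸ hs))
      (hu.symm ▸ hdc).intervalIntegrable]
    have hinv : ∀ s ∈ Set.Icc α β, |(ψ s)⁻¹| ≤ μ⁻¹ := fun s hs => by
      rw [abs_inv]; exact inv_anti₀ hμ (hψμ s hs)
    have i1 := abs_le.1 (hinv α ⟨le_rfl, hαβ⟩)
    have i2 := abs_le.1 (hinv β ⟨hαβ, le_rfl⟩)
    have j1 : g β / μ ≤ G / μ := div_le_div_of_nonneg_right (hG β) hμ.le
    have j2 : 0 ≤ g α / μ := div_nonneg (hg0 α) hμ.le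
    have j3 := mul_le_mul_of_nonneg_left i1.1 hG0
    have j4 := mul_le_mul_of_nonneg_left i2.2 hG0
    have : 3 * G / μ = G / μ + G * μ⁻¹ + G * μ⁻¹ := by field_simp; ring
    linarith
  refine (norm_sub_le _ _).trans ((add_le_add (norm_sub_le _ _) hInt).trans ?_)
  have := hb α ⟨le_rfl, hαβ⟩
  have := hb β ⟨hαβ, le_rfl⟩
  have : 5 * G / μ = G / μ + G / μ + 3 * G / μ := by ring
  linarith

theorem norm_oscillatory_le_length {φ g : ℝ → ℝ} {α β G : ℝ} (hαβ : α ≤ β)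
    (hg0 : ∀ s, 0 ≤ g s) (hG : ∀ s, g s ≤ G) :
    ‖∫ s in α..β, Complex.exp (Complex.I * φ s) * g s‖ ≤ G * (β - α) := by
  have := intervalIntegral.norm_integral_le_of_norm_le_const (a := α) (b := β) (C := G)
    (f := fun s => Complex.exp (Complex.I * φ s) * g s) fun s _ => by
      rw [norm_mul, mul_comm Complex.I, Complex.norm_exp_ofReal_mul_I, one_mul, Complex.norm_real,
        Real.norm_eq_abs, abs_of_nonneg (hg0 s)]
      exact hG s
  rwa [abs_of_nonneg (sub_nonneg.2 hαβ)] at this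

/-- Second derivative test for oscillatory integrals with concave phase. -/
theorem norm_oscillatory_le_of_slope {φ ψ ψ' g g' : ℝ → ℝ} {α β h G : ℝ} (hαβ : α ≤ β)
    (hh : 0 < h)
    (hφ : ∀ s, HasDerivAt φ (ψ s) s) (hψ : ∀ s, HasDerivAt ψ (ψ' s) s)
    (hg : ∀ s, HasDerivAt g (g' s) s) (hψ'c : Continuous ψ') (hg'c : Continuous g')
    (hψ' : ∀ s ∈ Set.Icc α β, ψ' s ≤ 0) (hg' : ∀ s ∈ Set.Icc α β, 0 ≤ g' s)
    (hg0 : ∀ s, 0 ≤ g s) (hG : ∀ s, g s ≤ G)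
    (hslope : ∀ s ∈ Set.Icc α β, ∀ s' ∈ Set.Icc α β, s ≤ s' → (s' - s) / h ^ 2 ≤ ψ s - ψ s') :
    ‖∫ s in α..β, Complex.exp (Complex.I * φ s) * g s‖ ≤ 12 * G * h := by
  have hG0 : 0 ≤ G := (hg0 0).trans (hG 0)
  have hψc : Continuous ψ := continuous_iff_continuousAt.2 fun s => (hψ s).continuousAt
  have hgc : Continuous g := continuous_iff_continuousAt.2 fun s => (hg s).continuousAt
  have hφc : Continuous φ := continuous_iff_continuousAt.2 fun s => (hφ s).continuousAt
  -- `c` is the stationary point if the phase velocity changes sign, and otherwise an endpoint,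
  -- where one of the two sign conditions is void.
  obtain ⟨c, hc, hc1, hc2⟩ : ∃ c ∈ Set.Icc α β,
      (c ≠ α → 0 ≤ ψ c) ∧ (c ≠ β → ψ c ≤ 0) := by
    by_cases h1 : ψ α ≤ 0
    · exact ⟨α, ⟨le_rfl, hαβ⟩, fun h => (h rfl).elim, fun _ => h1⟩
    by_cases h2 : 0 ≤ ψ β
    · exact ⟨β, ⟨hαβ, le_rfl⟩, fun _ => h2, fun h => (h rfl).elim⟩
    push Not at h1 h2
    obtain ⟨c, hc, hc0⟩ := intermediate_value_Icc' hαβ hψc.continuousOn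
      (show (0 : ℝ) ∈ Set.Icc (ψ β) (ψ α) from ⟨h2.le, h1.le⟩)
    exact ⟨c, hc, fun _ => hc0.ge, fun _ => hc0.le⟩
  have hint : ∀ x y : ℝ, IntervalIntegrable (fun s => Complex.exp (Complex.I * φ s) * g s)
      MeasureTheory.volume x y := fun x y =>
    (by fun_prop : Continuous fun s => Complex.exp (Complex.I * φ s) * (g s : ℂ)).intervalIntegrable
      _ _
  have hhi : h / h ^ 2 = h⁻¹ := by field_simp
  -- Within distance `h` of `c` the trivial bound gives `2 G h`. Outside, the slope condition forces
  -- `|ψ| ≥ h / h² = 1 / h`, and the first derivative test gives `5 G h` on each side.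
  set x := max α (c - h) with hx
  set y := min β (c + h) with hy
  have hαx : α ≤ x := le_max_left _ _
  have hxc : x ≤ c := max_le hc.1 (by linarith)
  have hcy : c ≤ y := le_min hc.2 (by linarith)
  have hyβ : y ≤ β := min_le_left _ _
  have e : ∫ s in α..β, Complex.exp (Complex.I * φ s) * g s
      = (∫ s in α..x, Complex.exp (Complex.I * φ s) * g s)
        + (∫ s in x..y, Complex.exp (Complex.I * φ s) * g s)
        + ∫ s in y..β, Complex.exp (Complex.I * φ s) * g s := by
    rw [intervalIntegral.integral_add_adjacent_intervals (hint _ _) (hint _ _),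
      intervalIntegral.integral_add_adjacent_intervals (hint _ _) (hint _ _)]
  have I2 : ‖∫ s in x..y, Complex.exp (Complex.I * φ s) * g s‖ ≤ 2 * G * h := by
    refine (norm_oscillatory_le_length (hxc.trans hcy) hg0 hG).trans ?_
    have : y - x ≤ 2 * h := by
      have := le_max_right α (c - h); have := min_le_right β (c + h); linarith
    nlinarith
  have five : 5 * G / h⁻¹ = 5 * G * h := by field_simp
  have I1 : ‖∫ s in α..x, Complex.exp (Complex.I * φ s) * g s‖ ≤ 5 * G * h := by
    rcases hαx.eq_or_lt with h0 | h0
    · rw [← h0, intervalIntegral.integral_same, norm_zero]; positivity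
    have hxe : x = c - h := by
      rcases max_choice α (c - h) with h' | h'
      · exact absurd (hx.trans h') h0.ne'
      · exact h'
    have hcα : c ≠ α := by rintro rfl; linarith
    rw [← five]
    refine norm_oscillatory_le_of_le_abs_deriv hαx (inv_pos.2 hh) hφ hψ hg hψ'c hg'c
      (fun s hs => hψ' s ⟨hs.1, hs.2.trans (hxc.trans hc.2)⟩)
      (fun s hs => hg' s ⟨hs.1, hs.2.trans (hxc.trans hc.2)⟩) hg0 hG fun s hs => ?_
    refine le_trans ?_ (le_abs_self _)
    have h3 := hslope s ⟨hs.1, hs.2.trans (hxc.trans hc.2)⟩ c hc (hs.2.trans hxc)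
    have h4 : h / h ^ 2 ≤ (c - s) / h ^ 2 := by
      gcongr; linarith [hs.2]
    linarith [hc1 hcα]
  have I3 : ‖∫ s in y..β, Complex.exp (Complex.I * φ s) * g s‖ ≤ 5 * G * h := by
    rcases hyβ.eq_or_lt with h0 | h0
    · rw [← h0, intervalIntegral.integral_same, norm_zero]; positivity
    have hye : y = c + h := by
      rcases min_choice β (c + h) with h' | h'
      · exact absurd (hy.trans h') h0.ne
      · exact h'
    have hcβ : c ≠ β := by rintro rfl; linarith
    rw [← five]
    refine norm_oscillatory_le_of_le_abs_deriv hyβ (inv_pos.2 hh) hφ hψ hg hψ'c hg'c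
      (fun s hs => hψ' s ⟨(hc.1.trans hcy).trans hs.1, hs.2⟩)
      (fun s hs => hg' s ⟨(hc.1.trans hcy).trans hs.1, hs.2⟩) hg0 hG fun s hs => ?_
    refine le_trans ?_ (neg_le_abs _)
    have h3 := hslope c hc s ⟨(hc.1.trans hcy).trans hs.1, hs.2⟩ (hcy.trans hs.1)
    have h4 : h / h ^ 2 ≤ (s - c) / h ^ 2 := by
      gcongr; linarith [hs.1]
    linarith [hc2 hcβ]
  rw [e]
  refine (norm_add₃_le).trans ?_
  linarith

/-! ### Pointwise decay of the oscillatory kernel. -/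

/-- `1 / √(1 - r² sin² s)`. -/
def amplitude (r s : ℝ) : ℝ := (√(1 - r ^ 2 * Real.sin s ^ 2))⁻¹

/-- The shifted dispersion relation `arcsin (r sin s)`. -/
def dispersion (r s : ℝ) : ℝ := Real.arcsin (r * Real.sin s)

/-- The group velocity of `dispersion`. -/
def velocity (r s : ℝ) : ℝ := r * Real.cos s * amplitude r s

/-- The oscillatory integral governing the kernel of the linear walk. -/
def halfKernel (r t x : ℝ) : ℂ :=
  ∫ s in (0 : ℝ)..Real.pi / 2,
    Complex.exp (Complex.I * ((t * dispersion r s - x * s : ℝ) : ℂ)) * amplitude r s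

theorem add_pow_four_le (a b : ℝ) : (a + b) ^ 4 ≤ 8 * (a ^ 4 + b ^ 4) := by
  nlinarith [sq_nonneg (a - b), sq_nonneg (a ^ 2 - b ^ 2), sq_nonneg (a + b), sq_nonneg (a * b),
    mul_nonneg (sq_nonneg (a - b)) (sq_nonneg (a + b)), mul_nonneg (sq_nonneg (a - b)) (sq_nonneg a),
    mul_nonneg (sq_nonneg (a - b)) (sq_nonneg b), mul_nonneg (sq_nonneg (a - b)) (sq_nonneg (a-b))]

theorem sub_sq_mul_sin_sq_ge (r s : ℝ) : 1 - r ^ 2 ≤ 1 - r ^ 2 * Real.sin s ^ 2 := by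
  nlinarith [Real.sin_sq_le_one s, sq_nonneg r]

section

variable {r : ℝ} (h0 : 0 < r) (h1 : r < 1)
include h0 h1

theorem one_sub_sq_pos : 0 < 1 - r ^ 2 := by nlinarith

theorem sub_sq_mul_sin_sq_pos (s : ℝ) : 0 < 1 - r ^ 2 * Real.sin s ^ 2 :=
  (one_sub_sq_pos h0 h1).trans_le (sub_sq_mul_sin_sq_ge r s)

theorem amplitude_pos (s : ℝ) : 0 < amplitude r s :=
  inv_pos.2 (Real.sqrt_pos.2 (sub_sq_mul_sin_sq_pos h0 h1 s))

theorem amplitude_le (s : ℝ) : amplitude r s ≤ (√(1 - r ^ 2))⁻¹ :=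
  inv_anti₀ (Real.sqrt_pos.2 (one_sub_sq_pos h0 h1))
    (Real.sqrt_le_sqrt (sub_sq_mul_sin_sq_ge r s))

theorem one_le_amplitude (s : ℝ) : 1 ≤ amplitude r s := by
  refine (one_le_inv₀ (Real.sqrt_pos.2 (sub_sq_mul_sin_sq_pos h0 h1 s))).2 ?_
  refine Real.sqrt_le_one.2 ?_
  nlinarith [sq_nonneg (r * Real.sin s)]

theorem amplitude_sq (s : ℝ) : amplitude r s ^ 2 * (1 - r ^ 2 * Real.sin s ^ 2) = 1 := by
  rw [amplitude, inv_pow, Real.sq_sqrt (sub_sq_mul_sin_sq_pos h0 h1 s).le]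
  exact inv_mul_cancel₀ (sub_sq_mul_sin_sq_pos h0 h1 s).ne'

theorem hasDerivAt_amplitude (s : ℝ) :
    HasDerivAt (amplitude r) (r ^ 2 * Real.sin s * Real.cos s * amplitude r s ^ 3) s := by
  have hp := sub_sq_mul_sin_sq_pos h0 h1 s
  have h := (((((Real.hasDerivAt_sin s).pow 2).const_mul (r ^ 2)).const_sub 1).sqrt hp.ne').inv
    (Real.sqrt_pos.2 hp).ne'
  refine h.congr_deriv ?_
  rw [amplitude]
  have := (Real.sqrt_pos.2 hp).ne'
  simp only [Pi.pow_apply]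
  field_simp
  norm_num
  ring

theorem hasDerivAt_dispersion (s : ℝ) : HasDerivAt (dispersion r) (velocity r s) s := by
  have hs := sub_sq_mul_sin_sq_pos h0 h1 s
  have hlt : |r * Real.sin s| < 1 := by
    rw [← sq_lt_one_iff_abs_lt_one, mul_pow]; linarith
  have h := (Real.hasDerivAt_arcsin (abs_lt.1 hlt).1.ne' (abs_lt.1 hlt).2.ne).comp s
    ((Real.hasDerivAt_sin s).const_mul r)
  refine h.congr_deriv ?_
  rw [velocity, amplitude, mul_pow, one_div]
  ring

theorem hasDerivAt_velocity (s : ℝ) :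
    HasDerivAt (velocity r) (-(r * (1 - r ^ 2) * Real.sin s * amplitude r s ^ 3)) s := by
  have h := ((Real.hasDerivAt_cos s).const_mul r).mul (hasDerivAt_amplitude h0 h1 s)
  refine h.congr_deriv ?_
  have e := amplitude_sq h0 h1 s
  have e2 := Real.sin_sq_add_cos_sq s
  linear_combination (r * Real.sin s * amplitude r s) * e
    + (r ^ 3 * Real.sin s * amplitude r s ^ 3) * e2

theorem continuous_amplitude : Continuous (amplitude r) :=
  continuous_iff_continuousAt.2 fun s => (hasDerivAt_amplitude h0 h1 s).continuousAt

theorem continuous_dispersion : Continuous (dispersion r) :=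
  continuous_iff_continuousAt.2 fun s => (hasDerivAt_dispersion h0 h1 s).continuousAt

theorem differentiable_velocity : Differentiable ℝ (velocity r) :=
  fun s => (hasDerivAt_velocity h0 h1 s).differentiableAt

/-- Jordan's inequality `sin u ≥ 2u/π` bounds the derivative of the velocity away from `0` once `u ≥
η`. The bound degenerates linearly at the inflection point `s = 0`. -/
theorem velocity_slope {η s s' : ℝ} (hη : 0 ≤ η) (hs : η ≤ s) (hss : s ≤ s')
    (hs' : s' ≤ Real.pi / 2) :
    r * (1 - r ^ 2) * (2 / Real.pi) * η * (s' - s) ≤ velocity r s - velocity r s' := by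
  have h := (convex_Icc η (Real.pi / 2)).image_sub_le_mul_sub_of_deriv_le
    (f := velocity r) (C := -(r * (1 - r ^ 2) * (2 / Real.pi) * η))
    (differentiable_velocity h0 h1).continuous.continuousOn
    (differentiable_velocity h0 h1).differentiableOn (fun u hu => ?_)
    s ⟨hs, hss.trans hs'⟩ s' ⟨hs.trans hss, hs'⟩ hss
  · linarith
  · rw [interior_Icc] at hu
    rw [(hasDerivAt_velocity h0 h1 u).deriv, neg_le_neg_iff]
    have i1 := Real.mul_le_sin (hη.trans hu.1.le) hu.2.le
    have i2 : 2 / Real.pi * η ≤ 2 / Real.pi * u :=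
      mul_le_mul_of_nonneg_left hu.1.le (by positivity)
    have i3 : (1 : ℝ) ≤ amplitude r u ^ 3 := one_le_pow₀ (one_le_amplitude h0 h1 u)
    have i4 : 0 ≤ r * (1 - r ^ 2) := (mul_pos h0 (one_sub_sq_pos h0 h1)).le
    have i5 : 0 ≤ 2 / Real.pi * η := by positivity
    calc r * (1 - r ^ 2) * (2 / Real.pi) * η = r * (1 - r ^ 2) * (2 / Real.pi * η) * 1 := by ring
      _ ≤ r * (1 - r ^ 2) * Real.sin u * amplitude r u ^ 3 := by
        refine mul_le_mul (mul_le_mul_of_nonneg_left (i2.trans i1) i4) i3 zero_le_one ?_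
        exact mul_nonneg i4 (i5.trans (i2.trans i1))

/-- The velocity is stationary at `s = 0`, where it takes its maximum `r`; hence the deviation is
quadratic. This fixes how far from `0` the first derivative test remains usable. -/
theorem sub_velocity_le {s : ℝ} (hs : 0 ≤ s) :
    r - velocity r s ≤ (√(1 - r ^ 2))⁻¹ ^ 3 * s ^ 2 := by
  have h := (convex_Icc 0 s).mul_sub_le_image_sub_of_le_deriv
    (f := velocity r) (C := -((√(1 - r ^ 2))⁻¹ ^ 3 * s))
    (differentiable_velocity h0 h1).continuous.continuousOn
    (differentiable_velocity h0 h1).differentiableOn (fun u hu => ?_)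
    0 ⟨le_rfl, hs⟩ s ⟨hs, le_rfl⟩ hs
  · have : velocity r 0 = r := by simp [velocity, amplitude]
    rw [this] at h
    linarith
  · rw [interior_Icc] at hu
    rw [(hasDerivAt_velocity h0 h1 u).deriv, neg_le_neg_iff]
    have i1 : Real.sin u ≤ s := (Real.sin_le hu.1.le).trans hu.2.le
    have i3 : amplitude r u ^ 3 ≤ (√(1 - r ^ 2))⁻¹ ^ 3 :=
      pow_le_pow_left₀ (amplitude_pos h0 h1 u).le (amplitude_le h0 h1 u) 3
    have i4 : 0 ≤ r * (1 - r ^ 2) := (mul_pos h0 (one_sub_sq_pos h0 h1)).le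
    have i5 : r * (1 - r ^ 2) ≤ 1 := by nlinarith [sq_nonneg r]
    have i6 : 0 ≤ amplitude r u ^ 3 := (pow_pos (amplitude_pos h0 h1 u) 3).le
    calc r * (1 - r ^ 2) * Real.sin u * amplitude r u ^ 3
        ≤ r * (1 - r ^ 2) * s * amplitude r u ^ 3 := by gcongr
      _ ≤ 1 * s * amplitude r u ^ 3 := by gcongr
      _ ≤ 1 * s * (√(1 - r ^ 2))⁻¹ ^ 3 := by gcongr
      _ = _ := by ring

theorem velocity_le {s : ℝ} (hs : 0 ≤ s) (hs' : s ≤ Real.pi / 2) : velocity r s ≤ r := by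
  have := velocity_slope h0 h1 le_rfl hs hs' le_rfl
  have h := velocity_slope h0 h1 le_rfl le_rfl hs hs'
  have : velocity r 0 = r := by simp [velocity, amplitude]
  rw [this] at h
  linarith

theorem hasDerivAt_phase (t x s : ℝ) :
    HasDerivAt (fun s => t * dispersion r s - x * s) (t * velocity r s - x) s := by
  exact (((hasDerivAt_dispersion h0 h1 s).const_mul t).sub
    ((hasDerivAt_id s).const_mul x)).congr_deriv (by rw [mul_one])

theorem hasDerivAt_phase_velocity (t x s : ℝ) :
    HasDerivAt (fun s => t * velocity r s - x)
      (t * -(r * (1 - r ^ 2) * Real.sin s * amplitude r s ^ 3)) s :=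
  ((hasDerivAt_velocity h0 h1 s).const_mul t).sub_const x

theorem phase_acceleration_nonpos {t s : ℝ} (ht : 0 ≤ t)
    (hs : s ∈ Set.Icc 0 (Real.pi / 2)) :
    t * -(r * (1 - r ^ 2) * Real.sin s * amplitude r s ^ 3) ≤ 0 := by
  have i1 := Real.sin_nonneg_of_nonneg_of_le_pi hs.1 (by linarith [hs.2, Real.pi_pos])
  have i4 : 0 ≤ r * (1 - r ^ 2) := (mul_pos h0 (one_sub_sq_pos h0 h1)).le
  have i6 : 0 ≤ amplitude r s ^ 3 := (pow_pos (amplitude_pos h0 h1 s) 3).le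
  have := mul_nonneg ht (mul_nonneg (mul_nonneg i4 i1) i6)
  linarith

theorem deriv_amplitude_nonneg {s : ℝ} (hs : s ∈ Set.Icc 0 (Real.pi / 2)) :
    0 ≤ r ^ 2 * Real.sin s * Real.cos s * amplitude r s ^ 3 := by
  have i1 := Real.sin_nonneg_of_nonneg_of_le_pi hs.1 (by linarith [hs.2, Real.pi_pos])
  have i2 := Real.cos_nonneg_of_neg_pi_div_two_le_of_le (by linarith [hs.1, Real.pi_pos]) hs.2
  have i6 : 0 ≤ amplitude r s ^ 3 := (pow_pos (amplitude_pos h0 h1 s) 3).le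
  positivity

/-- Second derivative test away from the inflection point; `h` is tuned to the lower bound of
`velocity_slope`. -/
theorem norm_halfKernel_far {t x η h : ℝ} (ht : 0 < t) (hη : 0 < η) (hη' : η ≤ Real.pi / 2)
    (hh : 0 < h) (hh2 : h ^ 2 * (t * (r * (1 - r ^ 2) * (2 / Real.pi)) * η) = 1) :
    ‖∫ s in η..Real.pi / 2,
      Complex.exp (Complex.I * ((t * dispersion r s - x * s : ℝ) : ℂ)) * amplitude r s‖
      ≤ 12 * (√(1 - r ^ 2))⁻¹ * h := by
  have ca := continuous_amplitude h0 h1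
  refine norm_oscillatory_le_of_slope hη' hh (hasDerivAt_phase h0 h1 t x)
    (hasDerivAt_phase_velocity h0 h1 t x) (hasDerivAt_amplitude h0 h1)
    (by fun_prop) (by fun_prop)
    (fun s hs => phase_acceleration_nonpos h0 h1 ht.le ⟨hη.le.trans hs.1, hs.2⟩)
    (fun s hs => deriv_amplitude_nonneg h0 h1 ⟨hη.le.trans hs.1, hs.2⟩)
    (fun s => (amplitude_pos h0 h1 s).le) (amplitude_le h0 h1) fun s hs s' hs' hss => ?_
  have h3 := mul_le_mul_of_nonneg_left (velocity_slope h0 h1 hη.le hs.1 hss hs'.2) ht.le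
  have : (s' - s) / h ^ 2 = t * (r * (1 - r ^ 2) * (2 / Real.pi) * η * (s' - s)) := by
    rw [div_eq_iff (by positivity)]
    linear_combination (s - s') * hh2
  rw [this]
  linarith

/-- On `[0, η]` the phase velocity stays within `|r t - x| / 2` of its value `r t - x` at `s = 0`,
so it is at least `|r t - x| / 2` in modulus and the first derivative test applies. -/
theorem norm_halfKernel_near {t x η : ℝ} (ht : 0 < t) (hη : 0 ≤ η) (hη' : η ≤ Real.pi / 2)
    (hD : 0 < |r * t - x|) (hηD : (√(1 - r ^ 2))⁻¹ ^ 3 * t * η ^ 2 ≤ |r * t - x| / 2) :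
    ‖∫ s in (0 : ℝ)..η,
      Complex.exp (Complex.I * ((t * dispersion r s - x * s : ℝ) : ℂ)) * amplitude r s‖
      ≤ 10 * (√(1 - r ^ 2))⁻¹ / |r * t - x| := by
  have ca := continuous_amplitude h0 h1
  have e : 10 * (√(1 - r ^ 2))⁻¹ / |r * t - x| = 5 * (√(1 - r ^ 2))⁻¹ / (|r * t - x| / 2) := by
    field_simp; norm_num
  rw [e]
  refine norm_oscillatory_le_of_le_abs_deriv hη (by positivity) (hasDerivAt_phase h0 h1 t x)
    (hasDerivAt_phase_velocity h0 h1 t x) (hasDerivAt_amplitude h0 h1)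
    (by fun_prop) (by fun_prop)
    (fun s hs => phase_acceleration_nonpos h0 h1 ht.le ⟨hs.1, hs.2.trans hη'⟩)
    (fun s hs => deriv_amplitude_nonneg h0 h1 ⟨hs.1, hs.2.trans hη'⟩)
    (fun s => (amplitude_pos h0 h1 s).le) (amplitude_le h0 h1) fun s hs => ?_
  have i1 := mul_le_mul_of_nonneg_left (sub_velocity_le h0 h1 hs.1) ht.le
  have i2 := mul_le_mul_of_nonneg_left (velocity_le h0 h1 hs.1 (hs.2.trans hη')) ht.le
  have i3 : (√(1 - r ^ 2))⁻¹ ^ 3 * t * s ^ 2 ≤ (√(1 - r ^ 2))⁻¹ ^ 3 * t * η ^ 2 := by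
    have := hs.1; have := hs.2; gcongr
  have i4 : |r * t - x| - |t * velocity r s - x| ≤ |(r * t - x) - (t * velocity r s - x)| :=
    abs_sub_abs_le_abs_sub _ _
  rw [abs_of_nonneg (by linarith : 0 ≤ (r * t - x) - (t * velocity r s - x))] at i4
  linarith

theorem halfKernel_eq_add (t x η : ℝ) : halfKernel r t x =
    (∫ s in (0 : ℝ)..η,
      Complex.exp (Complex.I * ((t * dispersion r s - x * s : ℝ) : ℂ)) * amplitude r s)
    + ∫ s in η..Real.pi / 2,
      Complex.exp (Complex.I * ((t * dispersion r s - x * s : ℝ) : ℂ)) * amplitude r s := by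
  have ca := continuous_amplitude h0 h1
  have cd := continuous_dispersion h0 h1
  rw [halfKernel, intervalIntegral.integral_add_adjacent_intervals] <;>
  exact Continuous.intervalIntegrable (by fun_prop) _ _

/-- Inside the caustic zone the stretch near the inflection point is estimated trivially. The cut `η
= t^(-1/3)` balances its length against the second derivative bound on the rest: both fourth powers
are multiples of `η / t`. -/
theorem norm_halfKernel_le_of_caustic {t x : ℝ} (ht : 1 ≤ t) (hD : |r * t - x| ^ 3 < t) :
    ‖halfKernel r t x‖ ^ 4 ≤
      16 * ((√(1 - r ^ 2))⁻¹ ^ 4 +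
        (12 * (√(1 - r ^ 2))⁻¹) ^ 4 / (r * (1 - r ^ 2) * (2 / Real.pi)) ^ 2)
        / (t * (1 + |r * t - x|)) := by
  have ht0 : 0 < t := zero_lt_one.trans_le ht
  set D := |r * t - x| with hDdef
  have hD0 : 0 ≤ D := abs_nonneg _
  set G := (√(1 - r ^ 2))⁻¹ with hG
  have hG0 : 0 < G := inv_pos.2 (Real.sqrt_pos.2 (one_sub_sq_pos h0 h1))
  set c := r * (1 - r ^ 2) * (2 / Real.pi) with hc
  have hc0 : 0 < c := mul_pos (mul_pos h0 (one_sub_sq_pos h0 h1)) (by positivity)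
  obtain ⟨η, hη0, hη3⟩ : ∃ η : ℝ, 0 < η ∧ η ^ 3 * t = 1 := by
    refine ⟨(t⁻¹) ^ ((1 : ℝ) / 3), by positivity, ?_⟩
    rw [← Real.rpow_natCast, ← Real.rpow_mul (by positivity)]
    norm_num
    exact inv_mul_cancel₀ ht0.ne'
  have hη1 : η ≤ 1 := by
    by_contra! h
    have : 1 < η ^ 3 := one_lt_pow₀ h (by norm_num)
    nlinarith
  have hηD : D * η ≤ 1 := by
    by_contra! h
    have h' : 1 < (D * η) ^ 3 := one_lt_pow₀ h (by norm_num)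
    have : (D * η) ^ 3 ≤ 1 := by
      rw [mul_pow, ← hη3, mul_comm]
      gcongr
    linarith
  have hK : 0 < t * c * η := by positivity
  set h := (√(t * c * η))⁻¹ with hh
  have hh0 : 0 < h := inv_pos.2 (Real.sqrt_pos.2 hK)
  have hh2 : h ^ 2 * (t * c * η) = 1 := by
    rw [hh, inv_pow, Real.sq_sqrt hK.le, inv_mul_cancel₀ hK.ne']
  have hηπ : η ≤ Real.pi / 2 := by linarith [Real.pi_gt_three]
  have b2 := norm_halfKernel_far h0 h1 (x := x) ht0 hη0 hηπ hh0 hh2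
  have b1 := norm_oscillatory_le_length (φ := fun s => t * dispersion r s - x * s) hη0.le
    (fun s => (amplitude_pos h0 h1 s).le) (amplitude_le h0 h1)
  have b : ‖halfKernel r t x‖ ≤ G * η + 12 * G * h := by
    rw [halfKernel_eq_add h0 h1 t x η]
    refine (norm_add_le _ _).trans (add_le_add (b1.trans_eq (by rw [sub_zero])) b2)
  have hh4 : h ^ 4 = η / (t * c ^ 2) := by
    rw [eq_div_iff (by positivity)]
    have e1 : h ^ 4 * (t * c * η) ^ 2 = 1 := by
      rw [← one_pow 2, ← hh2]; ring
    have : h ^ 4 * (t * c ^ 2) * (η ^ 3 * t) = η * (h ^ 4 * (t * c * η) ^ 2) := by ring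
    rw [hη3, e1] at this
    linarith
  have hη4 : η ^ 4 = η / t := by
    rw [eq_div_iff ht0.ne']; linear_combination η * hη3
  -- Both `η ≤ 1` and `D η ≤ 1` hold, so `η (1 + D) ≤ 2`.
  have key : η / t ≤ 2 / (t * (1 + D)) := by
    rw [div_le_div_iff₀ ht0 (by positivity)]
    nlinarith
  calc ‖halfKernel r t x‖ ^ 4 ≤ (G * η + 12 * G * h) ^ 4 :=
        pow_le_pow_left₀ (norm_nonneg _) b 4
    _ ≤ 8 * ((G * η) ^ 4 + (12 * G * h) ^ 4) := add_pow_four_le _ _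
    _ = 8 * (G ^ 4 + (12 * G) ^ 4 / c ^ 2) * (η / t) := by
        rw [mul_pow G, mul_pow (12 * G), hh4, hη4]
        field_simp
    _ ≤ 8 * (G ^ 4 + (12 * G) ^ 4 / c ^ 2) * (2 / (t * (1 + D))) := by gcongr
    _ = _ := by ring

/-- Outside the caustic zone the cut is the largest `η` that `norm_halfKernel_near` permits. The
near part contributes `D⁻⁴`, which is at most `1 / (t D)` because `t ≤ D³`; the far part is of order
`1 / (t D)` by the choice of `η`. -/
theorem norm_halfKernel_le_of_not_caustic {t x : ℝ} (ht : 1 ≤ t) (hD : t ≤ |r * t - x| ^ 3) :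
    ‖halfKernel r t x‖ ^ 4 ≤
      16 * ((10 * (√(1 - r ^ 2))⁻¹) ^ 4 +
        2 * (12 * (√(1 - r ^ 2))⁻¹) ^ 4 * (√(1 - r ^ 2))⁻¹ ^ 3
          / (r * (1 - r ^ 2) * (2 / Real.pi)) ^ 2)
        / (t * (1 + |r * t - x|)) := by
  have ht0 : 0 < t := zero_lt_one.trans_le ht
  set D := |r * t - x| with hDdef
  have hD1 : 1 ≤ D := by
    by_contra! h
    have : D ^ 3 < 1 := pow_lt_one₀ (abs_nonneg _) h (by norm_num)
    linarith
  have hD0 : 0 < D := zero_lt_one.trans_le hD1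
  set G := (√(1 - r ^ 2))⁻¹ with hG
  have hG0 : 0 < G := inv_pos.2 (Real.sqrt_pos.2 (one_sub_sq_pos h0 h1))
  set c := r * (1 - r ^ 2) * (2 / Real.pi) with hc
  have hc0 : 0 < c := mul_pos (mul_pos h0 (one_sub_sq_pos h0 h1)) (by positivity)
  set η := √(D / (2 * G ^ 3 * t)) with hη
  have hη0 : 0 < η := Real.sqrt_pos.2 (by positivity)
  have hη2 : η ^ 2 = D / (2 * G ^ 3 * t) := Real.sq_sqrt (by positivity)
  have hK : 0 < t * c * η := by positivity
  set h := (√(t * c * η))⁻¹ with hh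
  have hh0 : 0 < h := inv_pos.2 (Real.sqrt_pos.2 hK)
  have hh2 : h ^ 2 * (t * c * η) = 1 := by
    rw [hh, inv_pow, Real.sq_sqrt hK.le, inv_mul_cancel₀ hK.ne']
  have hηD : G ^ 3 * t * η ^ 2 = D / 2 := by rw [hη2]; field_simp
  have b : ‖halfKernel r t x‖ ≤ 10 * G / D + 12 * G * h := by
    rcases le_total η (Real.pi / 2) with h' | h'
    · rw [halfKernel_eq_add h0 h1 t x η]
      exact (norm_add_le _ _).trans (add_le_add
        (norm_halfKernel_near h0 h1 ht0 hη0.le h' hD0 hηD.le)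
        (norm_halfKernel_far h0 h1 ht0 hη0 h' hh0 hh2))
    -- When the cut lies beyond `π / 2`, the first derivative test covers the whole interval.
    · have := norm_halfKernel_near h0 h1 (x := x) ht0 (by positivity) (le_refl (Real.pi / 2)) hD0
        (le_trans (by gcongr) hηD.le)
      refine this.trans ?_
      have : 0 ≤ 12 * G * h := by positivity
      linarith
  have hh4 : h ^ 4 = 2 * G ^ 3 / c ^ 2 / (t * D) := by
    have e1 : h ^ 4 * (t * c) ^ 2 * η ^ 2 = 1 := by
      rw [← one_pow 2, ← hh2]; ring
    rw [hη2] at e1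
    field_simp at e1 ⊢
    linarith
  have hD4 : (1 / D) ^ 4 ≤ 1 / (t * D) := by
    rw [div_pow, one_pow]
    refine one_div_le_one_div_of_le (by positivity) ?_
    calc t * D ≤ D ^ 3 * D := by gcongr
      _ = D ^ 4 := by ring
  have key : 1 / (t * D) ≤ 2 / (t * (1 + D)) := by
    rw [div_le_div_iff₀ (by positivity) (by positivity)]
    nlinarith
  calc ‖halfKernel r t x‖ ^ 4 ≤ (10 * G / D + 12 * G * h) ^ 4 :=
        pow_le_pow_left₀ (norm_nonneg _) b 4
    _ ≤ 8 * ((10 * G / D) ^ 4 + (12 * G * h) ^ 4) := add_pow_four_le _ _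
    _ = 8 * ((10 * G) ^ 4 * (1 / D) ^ 4 + (12 * G) ^ 4 * (2 * G ^ 3 / c ^ 2 / (t * D))) := by
        rw [mul_pow (12 * G), hh4]; ring
    _ ≤ 8 * ((10 * G) ^ 4 * (1 / (t * D)) + (12 * G) ^ 4 * (2 * G ^ 3 / c ^ 2 / (t * D))) := by
        gcongr
    _ = 8 * ((10 * G) ^ 4 + 2 * (12 * G) ^ 4 * G ^ 3 / c ^ 2) * (1 / (t * D)) := by ring
    _ ≤ 8 * ((10 * G) ^ 4 + 2 * (12 * G) ^ 4 * G ^ 3 / c ^ 2) * (2 / (t * (1 + D))) := by gcongr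
    _ = _ := by ring

theorem exists_norm_halfKernel_le : ∃ C : ℝ, 0 < C ∧ ∀ t x : ℝ, 1 ≤ t →
    ‖halfKernel r t x‖ ^ 4 ≤ C / (t * (1 + |r * t - x|)) := by
  set G := (√(1 - r ^ 2))⁻¹ with hG
  have hG0 : 0 < G := inv_pos.2 (Real.sqrt_pos.2 (one_sub_sq_pos h0 h1))
  set c := r * (1 - r ^ 2) * (2 / Real.pi) with hc
  have hc0 : 0 < c := mul_pos (mul_pos h0 (one_sub_sq_pos h0 h1)) (by positivity)
  refine ⟨16 * (G ^ 4 + (12 * G) ^ 4 / c ^ 2) +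
    16 * ((10 * G) ^ 4 + 2 * (12 * G) ^ 4 * G ^ 3 / c ^ 2), by positivity, fun t x ht => ?_⟩
  have ht0 : 0 < t := zero_lt_one.trans_le ht
  rcases lt_or_ge (|r * t - x| ^ 3) t with hD | hD
  · refine (norm_halfKernel_le_of_caustic h0 h1 ht hD).trans ?_
    gcongr
    exact le_add_of_nonneg_right (by positivity)
  · refine (norm_halfKernel_le_of_not_caustic h0 h1 ht hD).trans ?_
    gcongr
    exact le_add_of_nonneg_left (by positivity)

end

/-! ### The scalar kernel and its space-time summability. -/

/-- The solution of `p (t + 2) x = r (p (t + 1) (x + 1) + p (t + 1) (x - 1)) - p t x` with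
`p 0 = 0` and `p 1 = δ₀`, that is, the Fourier coefficients of the Chebyshev polynomials of the
second kind at `r cos k`. -/
def scalarKernel (r : ℝ) (t : ℕ) (x : ℤ) : ℝ :=
  Real.pi⁻¹ * ∫ s in -(Real.pi / 2)..Real.pi / 2,
    Real.sin (t * (Real.pi / 2 - dispersion r s)) * Real.cos (x * (Real.pi / 2 - s)) *
      amplitude r s

theorem dispersion_neg (r s : ℝ) : dispersion r (-s) = -dispersion r s := by
  simp [dispersion]

theorem amplitude_neg (r s : ℝ) : amplitude r (-s) = amplitude r s := by
  simp [amplitude]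

theorem scalarKernel_zero (r : ℝ) (x : ℤ) : scalarKernel r 0 x = 0 := by
  simp [scalarKernel]

theorem tsum_inv_rpow_ne_top : ∑' x : ℤ, ENNReal.ofReal (1 / |(x : ℝ) + 1 / 2| ^ (5 / 4 : ℝ)) ≠ ⊤ :=
  ((Real.summable_one_div_int_add_rpow (1 / 2) (5 / 4)).2 (by norm_num)).tsum_ofReal_ne_top

/-- Translating by `⌊y⌋` makes the bound uniform in `y`. The shift by `1/2` keeps the comparison
series free of a zero denominator. -/
theorem tsum_translate_le (y : ℝ) :
    ∑' x : ℤ, ENNReal.ofReal ((1 + |y - x|) ^ (-(5 / 4) : ℝ)) ≤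
      ∑' x : ℤ, ENNReal.ofReal (1 / |(x : ℝ) + 1 / 2| ^ (5 / 4 : ℝ)) := by
  rw [← (Equiv.subLeft ⌊y⌋).tsum_eq
    (fun x : ℤ => ENNReal.ofReal (1 / |(x : ℝ) + 1 / 2| ^ (5 / 4 : ℝ)))]
  refine ENNReal.tsum_le_tsum fun x => ENNReal.ofReal_le_ofReal ?_
  rw [Real.rpow_neg (by positivity), one_div]
  have hne : 0 < |((Equiv.subLeft ⌊y⌋ x : ℤ) : ℝ) + 1 / 2| := by
    refine abs_pos.2 fun h => ?_
    have h2 : (2 * (Equiv.subLeft ⌊y⌋ x : ℤ) + 1 : ℝ) = 0 := by linarith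
    have h3 : 2 * (Equiv.subLeft ⌊y⌋ x : ℤ) + 1 = 0 := by exact_mod_cast h2
    omega
  refine inv_anti₀ (by positivity) (Real.rpow_le_rpow hne.le ?_ (by norm_num))
  have e : ((Equiv.subLeft ⌊y⌋ x : ℤ) : ℝ) + 1 / 2 = (y - x) + (⌊y⌋ - y + 1 / 2) := by
    simp only [Equiv.subLeft_apply, Int.cast_sub]; ring
  rw [e]
  refine (abs_add_le _ _).trans ?_
  have : |(⌊y⌋ : ℝ) - y + 1 / 2| ≤ 1 := by
    rw [abs_le]; constructor <;> linarith [Int.floor_le y, Int.lt_floor_add_one y]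
  linarith

section

variable {r : ℝ} (h0 : 0 < r) (h1 : r < 1)
include h0 h1

theorem sin_dispersion (s : ℝ) : Real.sin (dispersion r s) = r * Real.sin s := by
  have hs := sub_sq_mul_sin_sq_pos h0 h1 s
  have hlt : |r * Real.sin s| < 1 := by
    rw [← sq_lt_one_iff_abs_lt_one, mul_pow]; linarith
  exact Real.sin_arcsin (abs_lt.1 hlt).1.le (abs_lt.1 hlt).2.le

theorem cos_dispersion_mul_amplitude (s : ℝ) :
    Real.cos (dispersion r s) * amplitude r s = 1 := by
  rw [dispersion, Real.cos_arcsin, amplitude, mul_pow]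
  exact mul_inv_cancel₀ (Real.sqrt_pos.2 (sub_sq_mul_sin_sq_pos h0 h1 s)).ne'

/-- With `θ = π/2 - dispersion r s` and `k = π/2 - s` one has `cos θ = r cos k`. The recursion is
then the addition formula for `sin ((t + 1) θ ± θ)` combined with the one for `cos ((x ± 1) k)`. -/
theorem scalarKernel_add_two (t : ℕ) (x : ℤ) :
    scalarKernel r (t + 2) x =
      r * (scalarKernel r (t + 1) (x + 1) + scalarKernel r (t + 1) (x - 1)) - scalarKernel r t x := by
  have ca := continuous_amplitude h0 h1
  have cd := continuous_dispersion h0 h1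
  have hint : ∀ (t : ℕ) (x : ℤ), IntervalIntegrable (fun s =>
      Real.sin (t * (Real.pi / 2 - dispersion r s)) * Real.cos (x * (Real.pi / 2 - s)) *
      amplitude r s) MeasureTheory.volume (-(Real.pi / 2)) (Real.pi / 2) := fun t x =>
    Continuous.intervalIntegrable (by fun_prop) _ _
  simp only [scalarKernel]
  rw [← mul_add, mul_left_comm, ← mul_sub, ← intervalIntegral.integral_add (hint _ _) (hint _ _),
    ← intervalIntegral.integral_const_mul r, ← intervalIntegral.integral_sub _ (hint _ _)]
  · congr 1
    refine intervalIntegral.integral_congr fun s _ => ?_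
    have e := sin_dispersion h0 h1 s
    have e1 : Real.sin (((t + 2 : ℕ) : ℝ) * (Real.pi / 2 - dispersion r s))
        = 2 * (r * Real.sin s) * Real.sin (((t + 1 : ℕ) : ℝ) * (Real.pi / 2 - dispersion r s))
          - Real.sin (t * (Real.pi / 2 - dispersion r s)) := by
      rw [← e, ← Real.cos_pi_div_two_sub (dispersion r s)]
      generalize Real.pi / 2 - dispersion r s = u
      have a1 : ((t + 2 : ℕ) : ℝ) * u = ((t + 1 : ℕ) : ℝ) * u + u := by push_cast; ring
      have a2 : (t : ℝ) * u = ((t + 1 : ℕ) : ℝ) * u - u := by push_cast; ring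
      rw [a1, a2, Real.sin_add, Real.sin_sub]
      ring
    have e2 : Real.cos (((x + 1 : ℤ) : ℝ) * (Real.pi / 2 - s))
        + Real.cos (((x - 1 : ℤ) : ℝ) * (Real.pi / 2 - s))
        = 2 * Real.sin s * Real.cos (x * (Real.pi / 2 - s)) := by
      rw [← Real.cos_pi_div_two_sub s]
      generalize Real.pi / 2 - s = w
      have a1 : ((x + 1 : ℤ) : ℝ) * w = x * w + w := by push_cast; ring
      have a2 : ((x - 1 : ℤ) : ℝ) * w = x * w - w := by push_cast; ring
      rw [a1, a2, Real.cos_add, Real.cos_sub]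
      ring
    rw [e1]
    linear_combination (-r * Real.sin (((t + 1 : ℕ) : ℝ) * (Real.pi / 2 - dispersion r s))
      * amplitude r s) * e2
  · exact ((hint _ _).add (hint _ _)).const_mul _

theorem scalarKernel_one (x : ℤ) : scalarKernel r 1 x = if x = 0 then 1 else 0 := by
  have e : ∀ s, Real.sin (((1 : ℕ) : ℝ) * (Real.pi / 2 - dispersion r s)) *
      Real.cos (x * (Real.pi / 2 - s)) * amplitude r s = Real.cos (x * (Real.pi / 2 - s)) := by
    intro s
    rw [Nat.cast_one, one_mul, Real.sin_pi_div_two_sub]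
    linear_combination (Real.cos (x * (Real.pi / 2 - s))) * cos_dispersion_mul_amplitude h0 h1 s
  simp only [scalarKernel, e]
  rw [intervalIntegral.integral_comp_sub_left (fun w => Real.cos (x * w))]
  split_ifs with hx
  · simp [hx, Real.pi_ne_zero]
  · have hx' : (x : ℝ) ≠ 0 := by exact_mod_cast hx
    rw [intervalIntegral.integral_comp_mul_left _ hx', integral_cos]
    have : (x : ℝ) * (Real.pi / 2 - -(Real.pi / 2)) = x * Real.pi := by ring
    rw [this, Real.sin_int_mul_pi]
    simp

theorem abs_integral_sin_le (t x c : ℝ) :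
    |∫ s in (0 : ℝ)..Real.pi / 2, Real.sin (c + (t * dispersion r s - x * s)) * amplitude r s|
      ≤ ‖halfKernel r t x‖ := by
  have ca := continuous_amplitude h0 h1
  have cd := continuous_dispersion h0 h1
  have e : ∫ s in (0 : ℝ)..Real.pi / 2, Real.sin (c + (t * dispersion r s - x * s)) * amplitude r s
      = Complex.imCLM (Complex.exp (c * Complex.I) * halfKernel r t x) := by
    rw [halfKernel, ← intervalIntegral.integral_const_mul,
      ← ContinuousLinearMap.intervalIntegral_comp_comm]
    · refine intervalIntegral.integral_congr fun s _ => ?_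
      have : Complex.exp (c * Complex.I) *
          (Complex.exp (Complex.I * ((t * dispersion r s - x * s : ℝ) : ℂ)) * amplitude r s)
          = Complex.exp (((c + (t * dispersion r s - x * s) : ℝ) : ℂ) * Complex.I)
            * amplitude r s := by
        rw [← mul_assoc, ← Complex.exp_add]; congr 2; push_cast; ring
      rw [this, Complex.imCLM_apply, Complex.im_mul_ofReal, Complex.exp_ofReal_mul_I_im]
    · exact Continuous.intervalIntegrable (by fun_prop) _ _
  rw [e, Complex.imCLM_apply]
  refine (Complex.abs_im_le_norm _).trans ?_
  rw [norm_mul, Complex.norm_exp_ofReal_mul_I, one_mul]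

/-- Since `dispersion` is odd and `amplitude` even, each half of the interval gives the same
oscillatory integral up to a sign and a constant phase, hence at most one `halfKernel`. -/
theorem abs_integral_sin_symm_le (t x : ℝ) :
    |∫ s in -(Real.pi / 2)..Real.pi / 2,
      Real.sin (t * (Real.pi / 2 - dispersion r s) - x * (Real.pi / 2 - s)) * amplitude r s|
      ≤ 2 * ‖halfKernel r t x‖ := by
  have ca := continuous_amplitude h0 h1
  have cd := continuous_dispersion h0 h1
  have hint : ∀ a b : ℝ, IntervalIntegrable (fun s =>
      Real.sin (t * (Real.pi / 2 - dispersion r s) - x * (Real.pi / 2 - s)) * amplitude r s)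
      MeasureTheory.volume a b := fun a b => Continuous.intervalIntegrable (by fun_prop) _ _
  rw [← intervalIntegral.integral_add_adjacent_intervals (hint _ 0) (hint 0 _), two_mul]
  refine (abs_add_le _ _).trans (add_le_add ?_ ?_)
  · have := intervalIntegral.integral_comp_neg (a := 0) (b := Real.pi / 2) (fun s =>
      Real.sin (t * (Real.pi / 2 - dispersion r s) - x * (Real.pi / 2 - s)) * amplitude r s)
    rw [neg_zero] at this
    rw [← this]
    refine le_trans (le_of_eq ?_) (abs_integral_sin_le h0 h1 t x ((t - x) * (Real.pi / 2)))
    congr 1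
    refine intervalIntegral.integral_congr fun s _ => ?_
    rw [dispersion_neg, amplitude_neg]
    congr 2
    ring
  · rw [← abs_neg, ← intervalIntegral.integral_neg]
    refine le_trans (le_of_eq ?_) (abs_integral_sin_le h0 h1 t x (-((t - x) * (Real.pi / 2))))
    congr 1
    refine intervalIntegral.integral_congr fun s _ => ?_
    rw [← neg_mul, ← Real.sin_neg]
    congr 2
    ring

theorem abs_scalarKernel_le (t : ℕ) (x : ℤ) :
    |scalarKernel r t x| ≤ ‖halfKernel r t x‖ + ‖halfKernel r t (-x)‖ := by
  have ca := continuous_amplitude h0 h1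
  have cd := continuous_dispersion h0 h1
  have e : scalarKernel r t x = (2 * Real.pi)⁻¹ * ((∫ s in -(Real.pi / 2)..Real.pi / 2,
      Real.sin (t * (Real.pi / 2 - dispersion r s) - x * (Real.pi / 2 - s)) * amplitude r s)
      + ∫ s in -(Real.pi / 2)..Real.pi / 2,
      Real.sin (t * (Real.pi / 2 - dispersion r s) - (-x) * (Real.pi / 2 - s)) * amplitude r s) := by
    rw [← intervalIntegral.integral_add (Continuous.intervalIntegrable (by fun_prop) _ _)
      (Continuous.intervalIntegrable (by fun_prop) _ _), mul_inv, mul_comm (2⁻¹ : ℝ), mul_assoc,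
      ← intervalIntegral.integral_const_mul, scalarKernel]
    congr 1
    refine intervalIntegral.integral_congr fun s _ => ?_
    rw [neg_mul, sub_neg_eq_add, Real.sin_sub, Real.sin_add]
    ring
  rw [e, abs_mul, abs_of_pos (by positivity)]
  have b1 := abs_integral_sin_symm_le h0 h1 t x
  have b2 := abs_integral_sin_symm_le h0 h1 t (-x)
  have b := (abs_add_le _ _).trans (add_le_add b1 b2)
  refine (mul_le_mul_of_nonneg_left b (by positivity)).trans ?_
  rw [inv_mul_le_iff₀ (by positivity)]
  nlinarith [norm_nonneg (halfKernel r t x), norm_nonneg (halfKernel r t (-x)), Real.pi_gt_three]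

/-- The fourth power bound raised to `5/4` gives `t^(-5/4) (1 + |r t - x|)^(-5/4)`. The exponent
exceeds `1`, so the sum over `x` is bounded uniformly in `t` and the remaining factor is summable in
time. -/
theorem exists_tsum_halfKernel_pow_le : ∃ C : ENNReal, C ≠ ⊤ ∧ ∀ t : ℕ,
    ∑' x : ℤ, ENNReal.ofReal (‖halfKernel r ((t + 1 : ℕ) : ℝ) x‖ ^ 5)
      ≤ C * ENNReal.ofReal (((t + 1 : ℕ) : ℝ) ^ (-(5 / 4) : ℝ)) := by
  obtain ⟨C, hC, H⟩ := exists_norm_halfKernel_le h0 h1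
  refine ⟨ENNReal.ofReal (C ^ (5 / 4 : ℝ)) *
    ∑' x : ℤ, ENNReal.ofReal (1 / |(x : ℝ) + 1 / 2| ^ (5 / 4 : ℝ)),
    ENNReal.mul_ne_top ENNReal.ofReal_ne_top tsum_inv_rpow_ne_top, fun t => ?_⟩
  have ht : (1 : ℝ) ≤ ((t + 1 : ℕ) : ℝ) := by push_cast; linarith [(Nat.cast_nonneg t : (0 : ℝ) ≤ t)]
  set τ : ℝ := ((t + 1 : ℕ) : ℝ)
  have hτ : 0 < τ := zero_lt_one.trans_le ht
  have hx : ∀ x : ℤ, ENNReal.ofReal (‖halfKernel r τ x‖ ^ 5) ≤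
      ENNReal.ofReal (C ^ (5 / 4 : ℝ)) * ENNReal.ofReal (τ ^ (-(5 / 4) : ℝ)) *
        ENNReal.ofReal ((1 + |r * τ - x|) ^ (-(5 / 4) : ℝ)) := by
    intro x
    rw [← ENNReal.ofReal_mul (by positivity), ← ENNReal.ofReal_mul (by positivity)]
    refine ENNReal.ofReal_le_ofReal ?_
    have hb := Real.rpow_le_rpow (by positivity) (H τ x ht) (by norm_num : (0 : ℝ) ≤ 5 / 4)
    rw [← Real.rpow_natCast, ← Real.rpow_mul (norm_nonneg _)] at hb
    have e5 : ((4 : ℕ) : ℝ) * (5 / 4) = ((5 : ℕ) : ℝ) := by norm_num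
    rw [e5, Real.rpow_natCast, Real.div_rpow hC.le (by positivity),
      Real.mul_rpow hτ.le (by positivity)] at hb
    refine hb.trans_eq ?_
    rw [Real.rpow_neg hτ.le, Real.rpow_neg (by positivity)]
    field_simp
  refine (ENNReal.tsum_le_tsum hx).trans ?_
  rw [ENNReal.tsum_mul_left, mul_right_comm]
  exact mul_le_mul_left (mul_le_mul_right (tsum_translate_le _) _) _

theorem tsum_scalarKernel_pow_ne_top :
    ∑' (t : ℕ) (x : ℤ), ENNReal.ofReal (|scalarKernel r t x| ^ 5) ≠ ⊤ := by
  obtain ⟨C, hC, H⟩ := exists_tsum_halfKernel_pow_le h0 h1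
  rw [tsum_eq_zero_add' ENNReal.summable]
  simp only [scalarKernel_zero, abs_zero, ne_eq, OfNat.ofNat_ne_zero, not_false_eq_true, zero_pow,
    ENNReal.ofReal_zero, tsum_zero, zero_add]
  have hx : ∀ (t : ℕ), ∑' x : ℤ, ENNReal.ofReal (|scalarKernel r (t + 1) x| ^ 5)
      ≤ 32 * C * ENNReal.ofReal (((t + 1 : ℕ) : ℝ) ^ (-(5 / 4) : ℝ)) := by
    intro t
    have h2 : ∀ x : ℤ, ENNReal.ofReal (|scalarKernel r (t + 1) x| ^ 5) ≤
        16 * ENNReal.ofReal (‖halfKernel r ((t + 1 : ℕ) : ℝ) x‖ ^ 5)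
          + 16 * ENNReal.ofReal (‖halfKernel r ((t + 1 : ℕ) : ℝ) ((-x : ℤ) : ℝ)‖ ^ 5) := by
      intro x
      have e16 : (16 : ENNReal) = ENNReal.ofReal 16 := by norm_num
      rw [e16, ← ENNReal.ofReal_mul (by norm_num), ← ENNReal.ofReal_mul (by norm_num),
        ← ENNReal.ofReal_add (by positivity) (by positivity)]
      refine ENNReal.ofReal_le_ofReal ?_
      refine (pow_le_pow_left₀ (abs_nonneg _) (abs_scalarKernel_le h0 h1 _ _) 5).trans ?_
      rw [← mul_add, Int.cast_neg]
      exact (add_pow_le (norm_nonneg _) (norm_nonneg _) 5).trans_eq (by norm_num)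
    refine (ENNReal.tsum_le_tsum h2).trans ?_
    rw [ENNReal.tsum_add, ENNReal.tsum_mul_left, ENNReal.tsum_mul_left,
      show ∑' x : ℤ, ENNReal.ofReal (‖halfKernel r ((t + 1 : ℕ) : ℝ) ((-x : ℤ) : ℝ)‖ ^ 5)
        = ∑' x : ℤ, ENNReal.ofReal (‖halfKernel r ((t + 1 : ℕ) : ℝ) (x : ℝ)‖ ^ 5) from
        (Equiv.neg ℤ).tsum_eq (fun x : ℤ =>
        ENNReal.ofReal (‖halfKernel r ((t + 1 : ℕ) : ℝ) (x : ℝ)‖ ^ 5)), ← add_mul, mul_assoc]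
    have e32 : (16 + 16 : ENNReal) = 32 := by norm_num
    rw [e32]
    exact mul_le_mul_right (H t) _
  refine ne_top_of_le_ne_top ?_ (ENNReal.tsum_le_tsum hx)
  rw [ENNReal.tsum_mul_left]
  refine ENNReal.mul_ne_top (ENNReal.mul_ne_top (by norm_num) hC) (Summable.tsum_ofReal_ne_top ?_)
  have := (summable_nat_add_iff 1).2 (Real.summable_nat_rpow_inv.2 (by norm_num : (1 : ℝ) < 5 / 4))
  refine this.congr fun t => ?_
  rw [Real.rpow_neg (by positivity)]

end

/-! ### The linear walk expressed through the scalar kernel. -/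

theorem normSq_add_normSq_eq_one {a b : ℂ} {C₀ : U2}
    (hC₀ : (C₀ : Matrix (Fin 2) (Fin 2) ℂ) = !![a, b; -conj b, conj a]) :
    a * conj a + b * conj b = 1 := by
  have h := congrFun (congrFun (Matrix.mem_unitaryGroup_iff.1 C₀.2) 0) 0
  rw [hC₀, Matrix.star_eq_conjTranspose] at h
  simpa [Matrix.mul_apply, Fin.sum_univ_two] using h

theorem linearWalk_apply_zero {a b : ℂ} {C₀ : U2}
    (hC₀ : (C₀ : Matrix (Fin 2) (Fin 2) ℂ) = !![a, b; -conj b, conj a]) (v : State) (x : ℤ) :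
    linearWalk C₀ v x 0 = a * v (x + 1) 0 + b * v (x + 1) 1 := by
  change (act C₀ (v (x + 1))) 0 = _
  simp [act, hC₀, dotProduct, Fin.sum_univ_two]

theorem linearWalk_apply_one {a b : ℂ} {C₀ : U2}
    (hC₀ : (C₀ : Matrix (Fin 2) (Fin 2) ℂ) = !![a, b; -conj b, conj a]) (v : State) (x : ℤ) :
    linearWalk C₀ v x 1 = -conj b * v (x - 1) 0 + conj a * v (x - 1) 1 := by
  change (act C₀ (v (x - 1))) 1 = _
  simp [act, hC₀, dotProduct, Fin.sum_univ_two]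

/-- The linear walk satisfies a scalar second order recursion (Cayley-Hamilton). -/
theorem linearWalk_linearWalk_apply {a b : ℂ} {C₀ : U2}
    (hC₀ : (C₀ : Matrix (Fin 2) (Fin 2) ℂ) = !![a, b; -conj b, conj a]) (v : State) (x : ℤ) :
    linearWalk C₀ (linearWalk C₀ v) x =
      a • linearWalk C₀ v (x + 1) + conj a • linearWalk C₀ v (x - 1) - v x := by
  have h := normSq_add_normSq_eq_one hC₀
  ext i
  fin_cases i
  · simp only [Fin.zero_eta, PiLp.sub_apply, PiLp.add_apply, PiLp.smul_apply, smul_eq_mul,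
      linearWalk_apply_zero hC₀, linearWalk_apply_one hC₀, sub_add_cancel, add_sub_cancel_right]
    linear_combination (-(v x 0)) * h
  · simp only [Fin.mk_one, PiLp.sub_apply, PiLp.add_apply, PiLp.smul_apply, smul_eq_mul,
      linearWalk_apply_zero hC₀, linearWalk_apply_one hC₀, sub_add_cancel, add_sub_cancel_right]
    linear_combination (-(v x 1)) * h

/-- `scalarKernel` twisted by the phase of `a`. -/
def gaugedKernel (a : ℂ) (t : ℕ) (x : ℤ) : ℂ := (a / ‖a‖) ^ (-x) * scalarKernel ‖a‖ t x

section

variable {a : ℂ} (h0 : 0 < ‖a‖) (h1 : ‖a‖ < 1)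
include h0

theorem norm_gaugedKernel (t : ℕ) (x : ℤ) : ‖gaugedKernel a t x‖ = |scalarKernel ‖a‖ t x| := by
  have : ‖a / (‖a‖ : ℂ)‖ = 1 := by
    rw [norm_div, Complex.norm_real, norm_norm, div_self h0.ne']
  rw [gaugedKernel, norm_mul, norm_zpow, this, one_zpow, one_mul, Complex.norm_real,
    Real.norm_eq_abs]

include h1

/-- Writing `a = |a| c` with `|c| = 1`, the factor `c^(-x)` absorbs the phases `c` and `c̄` of the
two coefficients, leaving the real recursion with `r = |a|`. -/
theorem gaugedKernel_add_two (t : ℕ) (x : ℤ) :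
    gaugedKernel a (t + 2) x = a * gaugedKernel a (t + 1) (x + 1) +
      conj a * gaugedKernel a (t + 1) (x - 1) - gaugedKernel a t x := by
  have hr : (‖a‖ : ℂ) ≠ 0 := by exact_mod_cast h0.ne'
  have ha : a ≠ 0 := norm_pos_iff.1 h0
  set c : ℂ := a / ‖a‖ with hc
  have hc0 : c ≠ 0 := div_ne_zero ha hr
  have hac : a = ‖a‖ * c := by rw [hc]; field_simp
  have e1 : a * c ^ (-(x + 1)) = ‖a‖ * c ^ (-x) := by
    rw [neg_add, zpow_add₀ hc0, zpow_neg_one]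
    nth_rewrite 1 [hac]
    field_simp
  have e2 : conj a * c ^ (-(x - 1)) = ‖a‖ * c ^ (-x) := by
    rw [show -(x - 1) = -x + 1 by ring, zpow_add₀ hc0, zpow_one, hc]
    have : conj a * a = (‖a‖ : ℂ) ^ 2 := by
      rw [mul_comm, Complex.mul_conj, Complex.normSq_eq_norm_sq]; push_cast; ring
    field_simp
    linear_combination this
  simp only [gaugedKernel, ← hc, scalarKernel_add_two h0 h1]
  push_cast
  linear_combination (-(scalarKernel ‖a‖ (t + 1) (x + 1) : ℂ)) * e1
    - (scalarKernel ‖a‖ (t + 1) (x - 1) : ℂ) * e2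

theorem gaugedKernel_one (x : ℤ) : gaugedKernel a 1 x = if x = 0 then 1 else 0 := by
  rw [gaugedKernel, scalarKernel_one h0 h1]
  split_ifs with h
  · simp [h]
  · simp

omit h0 h1 in
theorem gaugedKernel_zero (x : ℤ) : gaugedKernel a 0 x = 0 := by
  simp [gaugedKernel, scalarKernel_zero]

omit h0 h1 in
theorem linearWalk_pow_succ_apply (C₀ : U2) (t : ℕ) (v : State) :
    (linearWalk C₀ ^ (t + 1)) v = linearWalk C₀ ((linearWalk C₀ ^ t) v) := by
  rw [pow_succ']; rfl

/-- This is the Chebyshev identity `U₀^(t+1) = p_(t+1) U₀ - p_t`, with `p_t` acting by convolution: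
both sides satisfy the recursion of `linearWalk_linearWalk_apply`. One step from a point mass at `y`
reaches only `y ± 1`, hence three terms. -/
theorem linearWalk_pow_single {b : ℂ} {C₀ : U2}
    (hC₀ : (C₀ : Matrix (Fin 2) (Fin 2) ℂ) = !![a, b; -conj b, conj a]) (y : ℤ) (e : Spin) (t : ℕ) :
    ∀ x, (linearWalk C₀ ^ (t + 1)) (lp.single 2 y e) x =
      gaugedKernel a (t + 1) (x - y + 1) • linearWalk C₀ (lp.single 2 y e) (y - 1) +
      gaugedKernel a (t + 1) (x - y - 1) • linearWalk C₀ (lp.single 2 y e) (y + 1) -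
      gaugedKernel a t (x - y) • e := by
  set v : State := lp.single 2 y e with hv
  have hvx : ∀ x, v x = if x = y then e else 0 := fun x => by
    rw [hv, lp.single_apply, Pi.single_apply]
  have base : ∀ x, (linearWalk C₀ ^ 1) v x =
      gaugedKernel a 1 (x - y + 1) • linearWalk C₀ v (y - 1) +
      gaugedKernel a 1 (x - y - 1) • linearWalk C₀ v (y + 1) - gaugedKernel a 0 (x - y) • e := by
    intro x
    rw [pow_one, gaugedKernel_one h0 h1, gaugedKernel_one h0 h1, gaugedKernel_zero, zero_smul,
      sub_zero]
    by_cases c1 : x = y - 1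
    · subst c1; norm_num
    by_cases c2 : x = y + 1
    · subst c2; norm_num
    rw [if_neg (by omega), if_neg (by omega), zero_smul, zero_smul, add_zero]
    ext i
    fin_cases i
    · rw [Fin.zero_eta, linearWalk_apply_zero hC₀, hvx, if_neg (by omega)]; simp
    · rw [Fin.mk_one, linearWalk_apply_one hC₀, hvx, if_neg (by omega)]; simp
  induction t using Nat.twoStepInduction with
  | zero => exact base
  | one =>
    intro x
    simp only [pow_one] at base
    have g2 : ∀ z, gaugedKernel a (1 + 1) z =
        a * gaugedKernel a 1 (z + 1) + conj a * gaugedKernel a 1 (z - 1) := fun z => by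
      have := gaugedKernel_add_two h0 h1 0 z
      rwa [gaugedKernel_zero, sub_zero] at this
    rw [linearWalk_pow_succ_apply, pow_one, linearWalk_linearWalk_apply hC₀, base (x + 1), base (x - 1), hvx, g2, g2]
    simp only [gaugedKernel_zero, sub_zero, zero_smul]
    rw [show x + 1 - y = x - y + 1 by ring, show x - 1 - y = x - y - 1 by ring]
    have : (if x = y then e else 0) = (if x - y = 0 then (1 : ℂ) else 0) • e := by
      by_cases h : x = y
      · simp [h]
      · simp [h, sub_ne_zero.2 h]
    rw [this]
    simp only [add_sub_cancel_right, sub_add_cancel]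
    rw [gaugedKernel_one h0 h1 (x - y)]
    module
  | more t ih1 ih2 =>
    intro x
    rw [linearWalk_pow_succ_apply, linearWalk_pow_succ_apply, linearWalk_linearWalk_apply hC₀,
      ← linearWalk_pow_succ_apply, ih2, ih2, ih1, gaugedKernel_add_two h0 h1 (t + 1) (x - y + 1),
      gaugedKernel_add_two h0 h1 (t + 1) (x - y - 1), gaugedKernel_add_two h0 h1 t (x - y)]
    rw [show x + 1 - y = x - y + 1 by ring, show x - 1 - y = x - y - 1 by ring]
    simp only [add_sub_cancel_right, sub_add_cancel]
    module

end

theorem add_add_pow_five_le {p q s : ℝ} (hp : 0 ≤ p) (hq : 0 ≤ q) (hs : 0 ≤ s) :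
    (p + q + s) ^ 5 ≤ 256 * (p ^ 5 + q ^ 5 + s ^ 5) := by
  have e1 := add_pow_le (add_nonneg hp hq) hs 5
  have e2 := add_pow_le hp hq 5
  have := pow_nonneg hs 5
  norm_num at e1 e2
  linarith

theorem exists_tsum_linearWalk_single {a b : ℂ} (h0 : 0 < ‖a‖) (h1 : ‖a‖ < 1) {C₀ : U2}
    (hC₀ : (C₀ : Matrix (Fin 2) (Fin 2) ℂ) = !![a, b; -conj b, conj a]) :
    ∃ A : ENNReal, A ≠ ⊤ ∧ ∀ (y : ℤ) (e : Spin),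
      ∑' (t : ℕ) (x : ℤ), ‖(linearWalk C₀ ^ t) (lp.single 2 y e) x‖ₑ ^ 5 ≤ A * ‖e‖ₑ ^ 5 := by
  set S := ∑' (t : ℕ) (x : ℤ), ENNReal.ofReal (|scalarKernel ‖a‖ t x| ^ 5) with hS
  have hSt : S ≠ ⊤ := tsum_scalarKernel_pow_ne_top h0 h1
  -- The `1` is time zero, where the walk is still the point mass; each later time is a sum of three
  -- kernel terms.
  refine ⟨1 + 256 * (S + S + S), by finiteness, fun y e => ?_⟩
  set v : State := lp.single 2 y e with hv
  have hα : ∀ x, ‖linearWalk C₀ v x‖ ≤ ‖e‖ := fun x => by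
    refine (lp.norm_apply_le_norm (by norm_num) _ x).trans ?_
    rw [LinearIsometryEquiv.norm_map, hv, lp.norm_single (by norm_num)]
  have hb : ∀ t x, ‖(linearWalk C₀ ^ (t + 1)) v x‖ₑ ^ 5 ≤ 256 *
      (ENNReal.ofReal (|scalarKernel ‖a‖ (t + 1) (x - y + 1)| ^ 5) +
        ENNReal.ofReal (|scalarKernel ‖a‖ (t + 1) (x - y - 1)| ^ 5) +
        ENNReal.ofReal (|scalarKernel ‖a‖ t (x - y)| ^ 5)) * ‖e‖ₑ ^ 5 := by
    intro t x
    have e256 : (256 : ENNReal) = ENNReal.ofReal 256 := by norm_num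
    rw [← ofReal_norm, ← ofReal_norm, ← ENNReal.ofReal_pow (norm_nonneg _),
      ← ENNReal.ofReal_pow (norm_nonneg _), e256,
      ← ENNReal.ofReal_add (by positivity) (by positivity),
      ← ENNReal.ofReal_add (by positivity) (by positivity), ← ENNReal.ofReal_mul (by positivity),
      ← ENNReal.ofReal_mul (by positivity)]
    refine ENNReal.ofReal_le_ofReal ?_
    have hn : ‖(linearWalk C₀ ^ (t + 1)) v x‖ ≤ (|scalarKernel ‖a‖ (t + 1) (x - y + 1)| +
        |scalarKernel ‖a‖ (t + 1) (x - y - 1)| + |scalarKernel ‖a‖ t (x - y)|) * ‖e‖ := by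
      rw [hv, linearWalk_pow_single h0 h1 hC₀, ← hv]
      refine (norm_sub_le _ _).trans ((add_le_add_left (norm_add_le _ _) _).trans ?_)
      rw [norm_smul, norm_smul, norm_smul, norm_gaugedKernel h0, norm_gaugedKernel h0,
        norm_gaugedKernel h0, add_mul, add_mul]
      have := hα (y - 1)
      have := hα (y + 1)
      gcongr
    refine (pow_le_pow_left₀ (norm_nonneg _) hn 5).trans ?_
    rw [mul_pow]
    gcongr
    exact add_add_pow_five_le (abs_nonneg _) (abs_nonneg _) (abs_nonneg _)
  have hshift : ∀ (t : ℕ) (k : ℤ), ∑' x : ℤ, ENNReal.ofReal (|scalarKernel ‖a‖ t (x - y + k)| ^ 5)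
      = ∑' x : ℤ, ENNReal.ofReal (|scalarKernel ‖a‖ t x| ^ 5) := fun t k => by
    rw [← (Equiv.addRight (-y + k)).tsum_eq (fun x => ENNReal.ofReal (|scalarKernel ‖a‖ t x| ^ 5))]
    simp only [Equiv.coe_addRight, sub_eq_add_neg, add_assoc]
  have hS1 : ∑' (t : ℕ) (x : ℤ), ENNReal.ofReal (|scalarKernel ‖a‖ (t + 1) x| ^ 5) ≤ S := by
    rw [hS, tsum_eq_zero_add' (f := fun t : ℕ =>
      ∑' x : ℤ, ENNReal.ofReal (|scalarKernel ‖a‖ t x| ^ 5)) ENNReal.summable]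
    exact le_add_self
  rw [tsum_eq_zero_add' ENNReal.summable, add_mul, one_mul]
  refine add_le_add ?_ ?_
  · refine le_of_eq ((tsum_eq_single y fun x hx => ?_).trans ?_)
    · change ‖v x‖ₑ ^ 5 = 0
      rw [hv, lp.single_apply, Pi.single_eq_of_ne hx]; simp
    · change ‖v y‖ₑ ^ 5 = _
      rw [hv, lp.single_apply, Pi.single_eq_same]
  · refine (ENNReal.tsum_le_tsum fun t => ENNReal.tsum_le_tsum (hb t)).trans ?_
    simp only [ENNReal.tsum_mul_right, ENNReal.tsum_mul_left, ENNReal.tsum_add]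
    refine mul_le_mul_left (mul_le_mul_right ?_ _) _
    have e0 : ∀ t : ℕ, ∑' x : ℤ, ENNReal.ofReal (|scalarKernel ‖a‖ t (x - y)| ^ 5)
      = ∑' x : ℤ, ENNReal.ofReal (|scalarKernel ‖a‖ t x| ^ 5) := fun t => by
      simpa using hshift t 0
    simp only [sub_eq_add_neg (_ - y) (1 : ℤ), hshift, e0]
    gcongr

/-! ### Space-time estimates from `ℓ¹` to `ℓ⁵`. -/

/-- Hölder with exponents `5/4` and `5` after splitting `w = w^(4/5) w^(1/5)`. -/
theorem tsum_mul_pow_five_le {ι : Type*} (w k : ι → ENNReal) :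
    (∑' i, w i * k i) ^ 5 ≤ (∑' i, w i) ^ 4 * ∑' i, w i * k i ^ 5 := by
  let _ : MeasurableSpace ι := ⊤
  have h := ENNReal.lintegral_mul_le_Lp_mul_Lq (MeasureTheory.Measure.count : MeasureTheory.Measure ι)
    (p := 5 / 4) (q := 5) ⟨by norm_num, by norm_num, by norm_num⟩
    (f := fun i => w i ^ (4 / 5 : ℝ)) (g := fun i => w i ^ (1 / 5 : ℝ) * k i)
    measurable_from_top.aemeasurable measurable_from_top.aemeasurable
  simp only [MeasureTheory.lintegral_count, Pi.mul_apply] at h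
  have e1 : ∀ i, w i ^ (4 / 5 : ℝ) * (w i ^ (1 / 5 : ℝ) * k i) = w i * k i := fun i => by
    rw [← mul_assoc, ← ENNReal.rpow_add_of_nonneg _ _ (by norm_num) (by norm_num)]; norm_num
  have e2 : ∀ i, (w i ^ (4 / 5 : ℝ)) ^ (5 / 4 : ℝ) = w i := fun i => by
    rw [← ENNReal.rpow_mul]; norm_num
  have e3 : ∀ i, (w i ^ (1 / 5 : ℝ) * k i) ^ (5 : ℝ) = w i * k i ^ 5 := fun i => by
    rw [ENNReal.mul_rpow_of_nonneg _ _ (by norm_num), ← ENNReal.rpow_mul, ← ENNReal.rpow_natCast]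
    norm_num
  simp only [e1, e2, e3] at h
  refine (pow_le_pow_left' h 5).trans_eq ?_
  rw [mul_pow, ← ENNReal.rpow_natCast, ← ENNReal.rpow_natCast, ← ENNReal.rpow_natCast,
    ← ENNReal.rpow_mul, ← ENNReal.rpow_mul]
  norm_num

/-- Minkowski's inequality in `ℓ⁵`, with summand-wise bounds. -/
theorem tsum_tsum_pow_five_le {ι Z : Type*} (F : ι → Z → ENNReal) (w : ι → ENNReal) (B : ENNReal)
    (hw : ∀ i, w i ≠ ⊤) (hF : ∀ i, ∑' z, F i z ^ 5 ≤ B * w i ^ 5) :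
    ∑' z, (∑' i, F i z) ^ 5 ≤ B * (∑' i, w i) ^ 5 := by
  have hzero : ∀ i, w i = 0 → ∀ z, F i z = 0 := fun i hi z => by
    have h := hF i
    rw [hi, zero_pow (by norm_num), mul_zero, nonpos_iff_eq_zero, ENNReal.tsum_eq_zero] at h
    exact pow_eq_zero_iff (by norm_num) |>.1 (h z)
  -- Each summand is normalised by its own bound; where `w i = 0` the hypothesis makes `F i` vanish,
  -- so the quotient is harmless.
  have hFw : ∀ i z, F i z = w i * (F i z / w i) := fun i z => by
    by_cases hi : w i = 0
    · rw [hzero i hi, hi, zero_mul]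
    · rw [ENNReal.mul_div_cancel hi (hw i)]
  calc ∑' z, (∑' i, F i z) ^ 5 = ∑' z, (∑' i, w i * (F i z / w i)) ^ 5 := by simp_rw [← hFw]
    _ ≤ ∑' z, (∑' i, w i) ^ 4 * ∑' i, w i * (F i z / w i) ^ 5 :=
        ENNReal.tsum_le_tsum fun z => tsum_mul_pow_five_le _ _
    _ = (∑' i, w i) ^ 4 * ∑' i, w i * ∑' z, (F i z / w i) ^ 5 := by
        rw [ENNReal.tsum_mul_left, ENNReal.tsum_comm]
        exact congrArg _ (tsum_congr fun i => ENNReal.tsum_mul_left)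
    _ ≤ (∑' i, w i) ^ 4 * ∑' i, w i * B := by
        refine mul_le_mul_right (ENNReal.tsum_le_tsum fun i => ?_) _
        by_cases hi : w i = 0
        · rw [hi]; simp
        gcongr
        simp_rw [div_eq_mul_inv, mul_pow]
        rw [ENNReal.tsum_mul_right, ← ENNReal.inv_pow, ← div_eq_mul_inv]
        exact ENNReal.div_le_of_le_mul (hF i)
    _ = B * (∑' i, w i) ^ 5 := by rw [ENNReal.tsum_mul_right]; ring

/-- The `ℓ¹` norm. -/
def l1 (f : ℤ → Spin) : ENNReal := ∑' x, ‖f x‖ₑ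

/-- The fifth power of the `ℓ⁵` norm. -/
def l5 (f : ℤ → Spin) : ENNReal := ∑' x, ‖f x‖ₑ ^ 5

theorem enorm_linearWalk_pow_apply_le (C₀ : U2) (t : ℕ) (v : State) (x : ℤ) :
    ‖(linearWalk C₀ ^ t) v x‖ₑ ≤ ∑' y, ‖(linearWalk C₀ ^ t) (lp.single 2 y (v y)) x‖ₑ := by
  have h1 := (lp.hasSum_single (p := 2) (by norm_num) v).mapL
    ((linearWalk C₀ ^ t).toContinuousLinearEquiv : State →L[ℂ] State)
  have h2 := h1.mapL (lp.evalCLM ℂ (fun _ : ℤ => Spin) 2 x)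
  have h3 : (linearWalk C₀ ^ t) v x = ∑' y, (linearWalk C₀ ^ t) (lp.single 2 y (v y)) x :=
    h2.tsum_eq.symm
  rw [h3]
  exact enorm_tsum_le_tsum_enorm

/-- Data are superpositions of point masses, and the point mass bound is uniform in the position;
Minkowski's inequality adds them with weights `‖v y‖`. -/
theorem exists_tsum_linearWalk_pow {a b : ℂ} (h0 : 0 < ‖a‖) (h1 : ‖a‖ < 1) {C₀ : U2}
    (hC₀ : (C₀ : Matrix (Fin 2) (Fin 2) ℂ) = !![a, b; -conj b, conj a]) :
    ∃ A : ENNReal, A ≠ ⊤ ∧ ∀ v : State,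
      ∑' t : ℕ, l5 ((linearWalk C₀ ^ t) v) ≤ A * l1 v ^ 5 := by
  obtain ⟨A, hA, H⟩ := exists_tsum_linearWalk_single h0 h1 hC₀
  refine ⟨A, hA, fun v => ?_⟩
  have h := tsum_tsum_pow_five_le
    (fun (y : ℤ) (z : ℕ × ℤ) => ‖(linearWalk C₀ ^ z.1) (lp.single 2 y (v y)) z.2‖ₑ)
    (fun y => ‖v y‖ₑ) A (fun _ => enorm_ne_top) fun y => by
      rw [ENNReal.tsum_prod']; exact H y (v y)
  rw [ENNReal.tsum_prod'] at h
  refine le_trans ?_ h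
  simp only [l5]
  gcongr with t x
  exact enorm_linearWalk_pow_apply_le C₀ t v x

theorem duhamel {C₀ : U2} {d f : ℕ → State} (hd : ∀ t, d (t + 1) = linearWalk C₀ (d t + f t))
    (t : ℕ) : d t = (linearWalk C₀ ^ t) (d 0) +
      ∑ s ∈ Finset.range t, (linearWalk C₀ ^ (t - s)) (f s) := by
  induction t with
  | zero => simp
  | succ t ih =>
    have e : ∀ s ∈ Finset.range t, (linearWalk C₀ ^ (t + 1 - s)) (f s)
        = linearWalk C₀ ((linearWalk C₀ ^ (t - s)) (f s)) := fun s hs => by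
      rw [Nat.succ_sub (Finset.mem_range.1 hs).le, linearWalk_pow_succ_apply]
    rw [hd, map_add, ih, map_add, map_sum, Finset.sum_range_succ, Finset.sum_congr rfl e,
      linearWalk_pow_succ_apply, Nat.add_sub_cancel_left, pow_one, add_assoc]

theorem state_sum_apply {ι : Type*} (S : Finset ι) (F : ι → State) (x : ℤ) :
    (∑ i ∈ S, F i) x = ∑ i ∈ S, F i x := by
  rw [lp.coeFn_sum, Finset.sum_apply]

theorem tsum_retarded (G : ℕ → ℤ → ENNReal) (s : ℕ) :
    ∑' (t : ℕ) (x : ℤ), (if s ≤ t then G (t - s) x else 0) ^ 5 = ∑' (t : ℕ) (x : ℤ), G t x ^ 5 := by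
  set K : ℕ → ENNReal := fun t => ∑' x : ℤ, (if s ≤ t then G (t - s) x else 0) ^ 5 with hK
  have h : ∑ t ∈ Finset.range s, K t + ∑' t, K (t + s) = ∑' t, K t :=
    Summable.sum_add_tsum_nat_add' ENNReal.summable
  rw [← h, hK, Finset.sum_eq_zero, zero_add]
  · refine tsum_congr fun t => tsum_congr fun x => ?_
    rw [if_pos (Nat.le_add_left s t), Nat.add_sub_cancel]
  · intro t ht
    simp [not_le.2 (Finset.mem_range.1 ht)]

/-- Inhomogeneous space-time estimate for the linear walk. -/
theorem exists_spacetime_bound {a b : ℂ} (h0 : 0 < ‖a‖) (h1 : ‖a‖ < 1) {C₀ : U2}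
    (hC₀ : (C₀ : Matrix (Fin 2) (Fin 2) ℂ) = !![a, b; -conj b, conj a]) :
    ∃ A : ENNReal, A ≠ ⊤ ∧ ∀ d f : ℕ → State, (∀ t, d (t + 1) = linearWalk C₀ (d t + f t)) →
      ∀ T : ℕ, ∑ t ∈ Finset.range (T + 1), l5 (d t) ≤
        A * (l1 (d 0) + ∑ s ∈ Finset.range T, l1 (f s)) ^ 5 := by
  obtain ⟨A, hA, H⟩ := exists_tsum_linearWalk_pow h0 h1 hC₀
  -- `A + 1` is nonzero, so the right side is infinite when the data or sources have infinite `ℓ¹`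
  -- norm.
  refine ⟨A + 1, by finiteness, fun d f hd T => ?_⟩
  by_cases htop : l1 (d 0) + ∑ s ∈ Finset.range T, l1 (f s) = ⊤
  · rw [htop, ENNReal.top_pow (by norm_num), ENNReal.mul_top (by simp)]
    exact le_top
  rw [ENNReal.add_eq_top, ENNReal.sum_eq_top, not_or] at htop
  push Not at htop
  obtain ⟨hd0, hf⟩ := htop
  -- `none` carries the free evolution of `d 0`, and `some s` the Duhamel term of the source at time
  -- `s`, switched on from time `s`.
  let F : Option (Fin T) → ℕ × ℤ → ENNReal := fun i z => i.elim ‖(linearWalk C₀ ^ z.1) (d 0) z.2‖ₑ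
    fun s => if (s : ℕ) ≤ z.1 then ‖(linearWalk C₀ ^ (z.1 - s)) (f s) z.2‖ₑ else 0
  let w : Option (Fin T) → ENNReal := fun i => i.elim (l1 (d 0)) fun s => l1 (f s)
  have h := tsum_tsum_pow_five_le F w A (fun i => by
    cases i with
    | none => exact hd0
    | some s => exact hf s (Finset.mem_range.2 s.2)) (fun i => by
    rw [ENNReal.tsum_prod']
    cases i with
    | none => exact H (d 0)
    | some s =>
      exact (tsum_retarded (fun t x => ‖(linearWalk C₀ ^ t) (f s) x‖ₑ) s).trans_le (H (f s)))
  have hw : ∑' i, w i = l1 (d 0) + ∑ s ∈ Finset.range T, l1 (f s) := by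
    rw [tsum_fintype, Fintype.sum_option, Finset.sum_range]
    rfl
  rw [hw] at h
  refine le_trans ?_ (h.trans (mul_le_mul_left le_self_add _))
  rw [ENNReal.tsum_prod']
  refine le_trans ?_ (ENNReal.sum_le_tsum (Finset.range (T + 1)))
  refine Finset.sum_le_sum fun t ht => ENNReal.tsum_le_tsum fun x => ?_
  refine pow_le_pow_left' ?_ 5
  rw [tsum_fintype, Fintype.sum_option, duhamel hd t, lp.coeFn_add, Pi.add_apply, state_sum_apply]
  refine (enorm_add_le _ _).trans (add_le_add le_rfl ((enorm_sum_le _ _).trans ?_))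
  have hsub : Finset.range t ⊆ Finset.range T :=
    Finset.range_subset_range.2 (Nat.lt_succ_iff.1 (Finset.mem_range.1 ht))
  refine le_trans ?_ (Finset.sum_range
    (fun s => if s ≤ t then ‖(linearWalk C₀ ^ (t - s)) (f s) x‖ₑ else 0)).le
  refine le_trans (Finset.sum_le_sum fun s hs => ?_) (Finset.sum_le_sum_of_subset hsub)
  rw [if_pos (Finset.mem_range.1 hs).le]

/-! ### The quintic nonlinearity and the small data bootstrap. -/

/-- The nonlinear part `Ĉ_N u - u` of one step of the walk. -/
def nonlinearity (CN : ℝ → ℝ → U2) (u : State) : State := coinOp CN u - u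

theorem nonlinearity_apply (CN : ℝ → ℝ → U2) (u : State) (x : ℤ) :
    nonlinearity CN u x = act (CN (‖u x 0‖ ^ 2) (‖u x 1‖ ^ 2)) (u x) - u x := rfl

theorem step_eq (C₀ : U2) (CN : ℝ → ℝ → U2) (u : State) :
    step (fun s₁ s₂ => C₀ * CN s₁ s₂) u = linearWalk C₀ (u + nonlinearity CN u) := by
  rw [nonlinearity, add_sub_cancel]
  change shift _ = shift _
  congr 1
  ext1; funext x
  exact act_mul _ _ _

theorem evolution_succ (C₀ : U2) (CN : ℝ → ℝ → U2) (u₀ : State) (t : ℕ) :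
    evolution (fun s₁ s₂ => C₀ * CN s₁ s₂) (t + 1) u₀ =
      linearWalk C₀ (evolution (fun s₁ s₂ => C₀ * CN s₁ s₂) t u₀ +
        nonlinearity CN (evolution (fun s₁ s₂ => C₀ * CN s₁ s₂) t u₀)) := by
  rw [← step_eq]
  exact Function.iterate_succ_apply' _ _ _

theorem norm_act_sub_le (A B : U2) (v : Spin) :
    ‖act A v - act B v‖ ≤
      ‖(A : Matrix (Fin 2) (Fin 2) ℂ) - (B : Matrix (Fin 2) (Fin 2) ℂ)‖ * ‖v‖ := by
  have h := Matrix.l2_opNorm_mulVec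
    ((A : Matrix (Fin 2) (Fin 2) ℂ) - (B : Matrix (Fin 2) (Fin 2) ℂ)) v
  rw [Matrix.sub_mulVec] at h
  exact h

theorem pow_four_add_pow_four_le (v : Spin) : ‖v 0‖ ^ 4 + ‖v 1‖ ^ 4 ≤ ‖v‖ ^ 4 := by
  have h : ‖v‖ ^ 4 = (‖v 0‖ ^ 2 + ‖v 1‖ ^ 2) ^ 2 := by rw [← norm_sq_spin]; ring
  rw [h]
  nlinarith [mul_nonneg (sq_nonneg ‖v 0‖) (sq_nonneg ‖v 1‖)]

section

variable {CN CNtilde : ℝ → ℝ → U2}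
  (hCN : ∀ s₁ s₂ : ℝ, 0 ≤ s₁ → 0 ≤ s₂ → CN s₁ s₂ = CNtilde (s₁ ^ 2) (s₂ ^ 2))
include hCN

theorem nonlinearity_apply_eq (u : State) (x : ℤ) : nonlinearity CN u x =
    act (CNtilde (‖u x 0‖ ^ 4) (‖u x 1‖ ^ 4)) (u x) - act 1 (u x) := by
  rw [nonlinearity_apply, hCN _ _ (sq_nonneg _) (sq_nonneg _), act_one, ← pow_mul, ← pow_mul]

variable {K : ℝ} (hK : 0 ≤ K) (hA : ∀ s₁ s₂ : ℝ,
      ‖(CNtilde s₁ s₂ : Matrix (Fin 2) (Fin 2) ℂ) - 1‖ ≤ K * (|s₁| + |s₂|))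
include hK hA

omit hCN in
theorem norm_coin_sub_one_le (v : Spin) :
    ‖(CNtilde (‖v 0‖ ^ 4) (‖v 1‖ ^ 4) : Matrix (Fin 2) (Fin 2) ℂ) - 1‖ ≤ K * ‖v‖ ^ 4 := by
  refine (hA _ _).trans (mul_le_mul_of_nonneg_left ?_ hK)
  rw [abs_of_nonneg (by positivity), abs_of_nonneg (by positivity)]
  exact pow_four_add_pow_four_le v

theorem norm_nonlinearity_apply_le (u : State) (x : ℤ) :
    ‖nonlinearity CN u x‖ ≤ K * ‖u x‖ ^ 5 := by
  rw [nonlinearity_apply_eq hCN]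
  refine (norm_act_sub_le _ _ _).trans ?_
  refine (mul_le_mul_of_nonneg_right (norm_coin_sub_one_le hK hA (u x)) (norm_nonneg _)).trans_eq ?_
  ring

theorem l1_nonlinearity_le (u : State) : l1 (nonlinearity CN u) ≤ ENNReal.ofReal K * l5 u := by
  rw [l1, l5, ← ENNReal.tsum_mul_left]
  refine ENNReal.tsum_le_tsum fun x => ?_
  rw [← ofReal_norm, ← ofReal_norm, ← ENNReal.ofReal_pow (norm_nonneg _), ← ENNReal.ofReal_mul hK]
  exact ENNReal.ofReal_le_ofReal (norm_nonlinearity_apply_le hCN hK hA u x)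

/-- Bootstrap: the nonlinear evolution of small `ℓ¹` data stays small in space-time `ℓ⁵`. -/
theorem sum_nonlinearity_le {C₀ : U2} {A : ENNReal}
    (H : ∀ d f : ℕ → State, (∀ t, d (t + 1) = linearWalk C₀ (d t + f t)) →
      ∀ T : ℕ, ∑ t ∈ Finset.range (T + 1), l5 (d t) ≤
        A * (l1 (d 0) + ∑ s ∈ Finset.range T, l1 (f s)) ^ 5)
    {u₀ : State} {m : ENNReal} (hu : l1 u₀ ≤ m)
    (hm : 32 * ENNReal.ofReal K * A * m ^ 4 ≤ 1) (T : ℕ) :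
    ∑ s ∈ Finset.range T,
      l1 (nonlinearity CN (evolution (fun s₁ s₂ => C₀ * CN s₁ s₂) s u₀)) ≤ m ∧
    ∑ s ∈ Finset.range T, l5 (evolution (fun s₁ s₂ => C₀ * CN s₁ s₂) s u₀) ≤ 32 * A * m ^ 5 := by
  induction T with
  | zero => simp
  | succ T ih =>
    -- Solutions up to time `T` involve only sources at times before `T`, so the inductive bound
    -- suffices. The factor `32 = 2⁵` comes from `(m + m)⁵`.
    have h5 : ∑ s ∈ Finset.range (T + 1), l5 (evolution (fun s₁ s₂ => C₀ * CN s₁ s₂) s u₀)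
        ≤ 32 * A * m ^ 5 := by
      refine (H _ _ (evolution_succ C₀ CN u₀) T).trans ?_
      refine (mul_le_mul_right (pow_le_pow_left' (add_le_add hu ih.1) 5) A).trans_eq ?_
      rw [← two_mul]
      ring
    refine ⟨?_, h5⟩
    refine (Finset.sum_le_sum fun s _ => l1_nonlinearity_le hCN hK hA _).trans ?_
    rw [← Finset.mul_sum]
    calc ENNReal.ofReal K * ∑ s ∈ Finset.range (T + 1), l5 _
        ≤ ENNReal.ofReal K * (32 * A * m ^ 5) := mul_le_mul_right h5 _
      _ = 32 * ENNReal.ofReal K * A * m ^ 4 * m := by ring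
      _ ≤ 1 * m := mul_le_mul_left hm m
      _ = m := one_mul m

end

/-! ### Scattering and the commutator of `W*` with `U₀`. -/

theorem enorm_le_l1 (v : State) : ‖v‖ₑ ≤ l1 v := by
  have h := (lp.hasSum_single (p := 2) (by norm_num) v).tsum_eq
  calc ‖v‖ₑ = ‖∑' y, (lp.single 2 y (v y) : State)‖ₑ := by rw [h]
    _ ≤ l1 v := ?_
  refine enorm_tsum_le_tsum_enorm.trans (ENNReal.tsum_le_tsum fun y => ?_)
  rw [← ofReal_norm, lp.norm_single (by norm_num), ofReal_norm]

theorem linearWalk_pow_succ_symm_apply (C₀ : U2) (t : ℕ) (w : State) :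
    (linearWalk C₀ ^ (t + 1)).symm w = (linearWalk C₀ ^ t).symm ((linearWalk C₀).symm w) := by
  rw [pow_succ']; rfl

theorem linearWalk_pow_succ_symm_apply' (C₀ : U2) (t : ℕ) (w : State) :
    (linearWalk C₀ ^ (t + 1)).symm w = (linearWalk C₀).symm ((linearWalk C₀ ^ t).symm w) := by
  rw [pow_succ]; rfl

/-- Undoing the free evolution leaves a plain sum of pulled-back sources, so convergence of the flow
becomes summability of the sources. -/
theorem interaction_picture {C₀ : U2} {d f : ℕ → State}
    (hd : ∀ t, d (t + 1) = linearWalk C₀ (d t + f t)) (t : ℕ) :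
    (linearWalk C₀ ^ t).symm (d t) =
      d 0 + ∑ s ∈ Finset.range t, (linearWalk C₀ ^ s).symm (f s) := by
  induction t with
  | zero => simp; rfl
  | succ t ih =>
    rw [linearWalk_pow_succ_symm_apply, hd, LinearIsometryEquiv.symm_apply_apply, map_add, ih,
      Finset.sum_range_succ, add_assoc]

theorem enorm_interaction_sub_le {C₀ : U2} {d f : ℕ → State}
    (hd : ∀ t, d (t + 1) = linearWalk C₀ (d t + f t)) (t : ℕ) :
    ‖(linearWalk C₀ ^ t).symm (d t) - d 0‖ₑ ≤ ∑ s ∈ Finset.range t, l1 (f s) := by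
  rw [interaction_picture hd, add_sub_cancel_left]
  refine (enorm_sum_le _ _).trans (Finset.sum_le_sum fun s _ => ?_)
  rw [LinearIsometryEquiv.enorm_map]
  exact enorm_le_l1 _

theorem isFinalData_iff (C₀ : U2) (CN : ℝ → ℝ → U2) (u₀ uplus : State) :
    IsFinalData C₀ CN u₀ uplus ↔ Tendsto (fun t : ℕ => (linearWalk C₀ ^ t).symm
      (evolution (fun s₁ s₂ => C₀ * CN s₁ s₂) t u₀)) atTop (𝓝 uplus) := by
  rw [tendsto_iff_norm_sub_tendsto_zero, IsFinalData]
  refine tendsto_congr fun t => ?_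
  rw [← LinearIsometryEquiv.norm_map (linearWalk C₀ ^ t)
    ((linearWalk C₀ ^ t).symm _ - uplus), map_sub, LinearIsometryEquiv.apply_symm_apply]

/-- The pulled-back nonlinearities are absolutely summable in `ℓ²`, since the free evolution is
isometric and `ℓ¹` dominates `ℓ²`; the final data are the initial data plus their sum. -/
theorem existsUnique_isFinalData {C₀ : U2} {CN : ℝ → ℝ → U2} {u₀ : State} {m : ENNReal}
    (hm : m ≠ ⊤) (h : ∀ T, ∑ s ∈ Finset.range T,
      l1 (nonlinearity CN (evolution (fun s₁ s₂ => C₀ * CN s₁ s₂) s u₀)) ≤ m) :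
    ∃! uplus, IsFinalData C₀ CN u₀ uplus := by
  simp only [isFinalData_iff]
  have hs : Summable fun s => (linearWalk C₀ ^ s).symm
      (nonlinearity CN (evolution (fun s₁ s₂ => C₀ * CN s₁ s₂) s u₀)) := by
    refine Summable.of_enorm (ne_top_of_le_ne_top hm ?_)
    rw [ENNReal.tsum_eq_iSup_nat]
    refine iSup_le fun T => le_trans (Finset.sum_le_sum fun s _ => ?_) (h T)
    rw [LinearIsometryEquiv.enorm_map]
    exact enorm_le_l1 _
  have hlim : Tendsto (fun t : ℕ => (linearWalk C₀ ^ t).symm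
      (evolution (fun s₁ s₂ => C₀ * CN s₁ s₂) t u₀)) atTop (𝓝 (u₀ + ∑' s, (linearWalk C₀ ^ s).symm
      (nonlinearity CN (evolution (fun s₁ s₂ => C₀ * CN s₁ s₂) s u₀)))) := by
    simp only [interaction_picture
      (d := fun t => evolution (fun s₁ s₂ => C₀ * CN s₁ s₂) t u₀) (evolution_succ C₀ CN u₀)]
    exact hs.hasSum.tendsto_sum_nat.const_add _
  exact ⟨_, hlim, fun y hy => tendsto_nhds_unique hy hlim⟩

theorem tendsto_Wstar {C₀ : U2} {CN : ℝ → ℝ → U2} {u₀ : State}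
    (h : ∃ uplus, IsFinalData C₀ CN u₀ uplus) : Tendsto (fun t : ℕ => (linearWalk C₀ ^ t).symm
      (evolution (fun s₁ s₂ => C₀ * CN s₁ s₂) t u₀)) atTop (𝓝 (Wstar C₀ CN u₀)) := by
  rw [← isFinalData_iff, Wstar, dif_pos h]
  exact h.choose_spec

/-- The commutator of `W*` with the linear walk is, up to the accumulated difference of the
nonlinearities, the nonlinearity itself. -/
theorem enorm_Wstar_commutator_sub_le {C₀ : U2} {CN : ℝ → ℝ → U2} {φ : State}
    (h : ∃ uplus, IsFinalData C₀ CN φ uplus)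
    (h' : ∃ uplus, IsFinalData C₀ CN (linearWalk C₀ φ) uplus) {R : ENNReal}
    (hR : ∀ T, ∑ s ∈ Finset.range T,
      l1 (nonlinearity CN (evolution (fun s₁ s₂ => C₀ * CN s₁ s₂) (s + 1) φ) -
        nonlinearity CN (evolution (fun s₁ s₂ => C₀ * CN s₁ s₂) s (linearWalk C₀ φ)) : State) ≤ R) :
    ‖Wstar C₀ CN φ - (linearWalk C₀).symm (Wstar C₀ CN (linearWalk C₀ φ)) - nonlinearity CN φ‖ₑ
      ≤ R := by
  set v := fun t => evolution (fun s₁ s₂ => C₀ * CN s₁ s₂) t φ with hv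
  set w := fun t => evolution (fun s₁ s₂ => C₀ * CN s₁ s₂) t (linearWalk C₀ φ) with hw
  -- The first evolution is read one step later, so that both have taken a first step from `φ`: a
  -- nonlinear one for `v`, a free one for `w`.
  have t1 : Tendsto (fun t => (linearWalk C₀ ^ (t + 1)).symm (v (t + 1))) atTop
    (𝓝 (Wstar C₀ CN φ)) := (tendsto_Wstar h).comp (tendsto_add_atTop_nat 1)
  have t2 : Tendsto (fun t => (linearWalk C₀).symm ((linearWalk C₀ ^ t).symm (w t))) atTop
    (𝓝 ((linearWalk C₀).symm (Wstar C₀ CN (linearWalk C₀ φ)))) :=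
    ((linearWalk C₀).symm.continuous.tendsto _).comp (tendsto_Wstar h')
  have t3 := ((t1.sub t2).sub_const (nonlinearity CN φ)).enorm
  refine le_of_tendsto t3 (Eventually.of_forall fun t => ?_)
  have hd : ∀ t, (v (t + 1 + 1) - w (t + 1)) = linearWalk C₀ ((v (t + 1) - w t) +
      (nonlinearity CN (v (t + 1)) - nonlinearity CN (w t))) := fun t => by
    simp only [hv, hw]
    rw [evolution_succ C₀ CN φ (t + 1), evolution_succ C₀ CN (linearWalk C₀ φ) t, ← map_sub]
    congr 1
    abel
  have h0 : v (0 + 1) - w 0 = linearWalk C₀ (nonlinearity CN φ) := by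
    have e0 : v (0 + 1) = linearWalk C₀ (φ + nonlinearity CN φ) := evolution_succ C₀ CN φ 0
    have e1 : w 0 = linearWalk C₀ φ := rfl
    rw [e0, e1, map_add, add_sub_cancel_left]
  have hb := enorm_interaction_sub_le (d := fun t => v (t + 1) - w t)
    (f := fun t => nonlinearity CN (v (t + 1)) - nonlinearity CN (w t)) hd t
  refine le_trans (le_of_eq ?_) (hb.trans (hR t))
  -- The initial difference is `U₀ N(φ)`; applying the isometry `U₀⁻¹` produces the commutator minus
  -- `N(φ)`.
  rw [h0, ← LinearIsometryEquiv.enorm_map (linearWalk C₀).symm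
    ((linearWalk C₀ ^ t).symm (v (t + 1) - w t) - _), map_sub (linearWalk C₀).symm,
    LinearIsometryEquiv.symm_apply_apply, map_sub (linearWalk C₀ ^ t).symm,
    map_sub (linearWalk C₀).symm, linearWalk_pow_succ_symm_apply']

/-! ### Comparison of two nonlinear evolutions. -/

theorem norm_coinOp (C : ℝ → ℝ → U2) (u : State) : ‖coinOp C u‖ = ‖u‖ :=
  norm_eq_of_norm_eq fun _ => norm_act _ _

theorem norm_evolution (C : ℝ → ℝ → U2) (t : ℕ) (u : State) : ‖evolution C t u‖ = ‖u‖ := by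
  induction t with
  | zero => rfl
  | succ t ih =>
    rw [evolution, Function.iterate_succ_apply', step, LinearIsometryEquiv.norm_map, norm_coinOp]
    exact ih

theorem norm_spin_le (v : Spin) : ‖v‖ ≤ ‖v 0‖ + ‖v 1‖ := by
  refine le_of_sq_le_sq ?_ (by positivity)
  rw [norm_sq_spin]
  nlinarith [mul_nonneg (norm_nonneg (v 0)) (norm_nonneg (v 1))]

theorem l1_linearWalk_le (C₀ : U2) (v : State) : l1 (linearWalk C₀ v) ≤ 2 * l1 v := by
  have hx : ∀ x, ‖linearWalk C₀ v x‖ₑ ≤ ‖v (x + 1)‖ₑ + ‖v (x - 1)‖ₑ := fun x => by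
    rw [← ofReal_norm, ← ofReal_norm, ← ofReal_norm, ← ENNReal.ofReal_add (norm_nonneg _)
      (norm_nonneg _)]
    refine ENNReal.ofReal_le_ofReal ((norm_spin_le _).trans ?_)
    have h1 := PiLp.norm_apply_le (act C₀ (v (x + 1))) 0
    have h2 := PiLp.norm_apply_le (act C₀ (v (x - 1))) 1
    rw [norm_act] at h1 h2
    exact add_le_add h1 h2
  refine (ENNReal.tsum_le_tsum hx).trans_eq ?_
  rw [ENNReal.tsum_add, two_mul]
  congr 1
  · exact (Equiv.addRight (1 : ℤ)).tsum_eq fun x => ‖v x‖ₑ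
  · exact (Equiv.subRight (1 : ℤ)).tsum_eq fun x => ‖v x‖ₑ

theorem l5_le (v : ℤ → Spin) : l5 v ≤ l1 v ^ 5 := by
  have : ∀ x, ‖v x‖ₑ ^ 5 ≤ l1 v ^ 4 * ‖v x‖ₑ := fun x => by
    rw [pow_succ]
    exact mul_le_mul_left (pow_le_pow_left' (ENNReal.le_tsum x) 4) _
  refine (ENNReal.tsum_le_tsum this).trans_eq ?_
  rw [ENNReal.tsum_mul_left, pow_succ (l1 v) 4]
  rfl

theorem abs_pow_four_sub_le {x y : ℝ} (hx : 0 ≤ x) (hy : 0 ≤ y) :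
    |x ^ 4 - y ^ 4| ≤ |x - y| * (x + y) ^ 3 := by
  have e : x ^ 4 - y ^ 4 = (x - y) * ((x + y) * (x ^ 2 + y ^ 2)) := by ring
  rw [e, abs_mul, abs_of_nonneg (by positivity : 0 ≤ (x + y) * (x ^ 2 + y ^ 2))]
  refine mul_le_mul_of_nonneg_left ?_ (abs_nonneg _)
  have : (x + y) ^ 3 = (x + y) * (x ^ 2 + y ^ 2) + (x + y) * (2 * x * y) := by ring
  rw [this]
  exact le_add_of_nonneg_right (by positivity)

theorem abs_norm_pow_four_sub_le (v w : Spin) (i : Fin 2) :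
    |‖v i‖ ^ 4 - ‖w i‖ ^ 4| ≤ ‖v - w‖ * (‖v‖ + ‖w‖) ^ 3 := by
  refine (abs_pow_four_sub_le (norm_nonneg _) (norm_nonneg _)).trans ?_
  have h1 := PiLp.norm_apply_le v i
  have h2 := PiLp.norm_apply_le w i
  have h3 : |‖v i‖ - ‖w i‖| ≤ ‖v - w‖ :=
    (abs_norm_sub_norm_le _ _).trans (PiLp.norm_apply_le (v - w) i)
  gcongr

/-- A weighted Young inequality, used with `a` a difference of scale `m` and `b` solutions of scale
`σ`. The weights make both terms of size `m σ⁴`, so pointwise bounds can be summed without a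
space-time Hölder inequality. -/
theorem mul_pow_four_le {a b m σ : ℝ} (ha : 0 ≤ a) (hb : 0 ≤ b) (hm : 0 < m) (hσ : 0 < σ) :
    a * b ^ 4 ≤ (σ / m) ^ 4 * a ^ 5 + m / σ * b ^ 5 := by
  rcases le_total (σ * a) (m * b) with h | h
  · have : a ≤ m / σ * b := by
      rw [div_mul_eq_mul_div, le_div_iff₀ hσ]; linarith
    calc a * b ^ 4 ≤ (m / σ * b) * b ^ 4 := by gcongr
      _ = m / σ * b ^ 5 := by ring
      _ ≤ _ := le_add_of_nonneg_left (by positivity)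
  · have : b ≤ σ / m * a := by
      rw [div_mul_eq_mul_div, le_div_iff₀ hm]; linarith
    calc a * b ^ 4 ≤ a * (σ / m * a) ^ 4 := by gcongr
      _ = (σ / m) ^ 4 * a ^ 5 := by ring
      _ ≤ _ := le_add_of_nonneg_right (by positivity)

theorem exists_lipschitz_coin {CNtilde : ℝ → ℝ → U2}
    (hC2 : ContDiff ℝ 2 fun p : ℝ × ℝ => (CNtilde p.1 p.2 : Matrix (Fin 2) (Fin 2) ℂ)) :
    ∃ L : ℝ, 0 ≤ L ∧ ∀ p₁ p₂ q₁ q₂ : ℝ, |p₁| ≤ 1 → |p₂| ≤ 1 → |q₁| ≤ 1 → |q₂| ≤ 1 →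
      ‖(CNtilde p₁ p₂ : Matrix (Fin 2) (Fin 2) ℂ) - CNtilde q₁ q₂‖ ≤
        L * (|p₁ - q₁| + |p₂ - q₂|) := by
  obtain ⟨L, hL⟩ := hC2.contDiffOn.exists_lipschitzOnWith (s := Metric.closedBall (0 : ℝ × ℝ) 1)
    (by norm_num) (convex_closedBall _ _) (isCompact_closedBall _ _)
  have hmem : ∀ p₁ p₂ : ℝ, |p₁| ≤ 1 → |p₂| ≤ 1 → (p₁, p₂) ∈ Metric.closedBall (0 : ℝ × ℝ) 1 :=
    fun p₁ p₂ h₁ h₂ => by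
      rw [mem_closedBall_zero_iff, Prod.norm_mk]
      exact max_le h₁ h₂
  refine ⟨L, L.2, fun p₁ p₂ q₁ q₂ h₁ h₂ h₃ h₄ => ?_⟩
  have h := hL.norm_sub_le (hmem p₁ p₂ h₁ h₂) (hmem q₁ q₂ h₃ h₄)
  refine h.trans (mul_le_mul_of_nonneg_left ?_ L.2)
  rw [Prod.mk_sub_mk, Prod.norm_mk]
  exact max_le (le_add_of_nonneg_right (abs_nonneg _)) (le_add_of_nonneg_left (abs_nonneg _))

section

variable {CN CNtilde : ℝ → ℝ → U2}
  (hCN : ∀ s₁ s₂ : ℝ, 0 ≤ s₁ → 0 ≤ s₂ → CN s₁ s₂ = CNtilde (s₁ ^ 2) (s₂ ^ 2))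
  {K : ℝ} (hK : 0 ≤ K) (hA : ∀ s₁ s₂ : ℝ,
      ‖(CNtilde s₁ s₂ : Matrix (Fin 2) (Fin 2) ℂ) - 1‖ ≤ K * (|s₁| + |s₂|))
  {L : ℝ} (hL0 : 0 ≤ L)
  (hL : ∀ p₁ p₂ q₁ q₂ : ℝ, |p₁| ≤ 1 → |p₂| ≤ 1 → |q₁| ≤ 1 → |q₂| ≤ 1 →
      ‖(CNtilde p₁ p₂ : Matrix (Fin 2) (Fin 2) ℂ) - CNtilde q₁ q₂‖ ≤
        L * (|p₁ - q₁| + |p₂ - q₂|))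
include hCN hK hA hL0 hL

/-- The coin varies between `u` and `w` (Lipschitz constant `L`, applicable since norms at most `1`
keep its arguments in the unit square), and the coin at `w` acts on `u - w` (smallness constant
`K`). -/
theorem norm_nonlinearity_sub_apply_le (u w : State) (hu : ‖u‖ ≤ 1) (hw : ‖w‖ ≤ 1) (x : ℤ) :
    ‖nonlinearity CN u x - nonlinearity CN w x‖ ≤
      (2 * L + K) * (‖u x - w x‖ * (‖u x‖ + ‖w x‖) ^ 4) := by
  have hle : ∀ (v : State), ‖v‖ ≤ 1 → ∀ i, |‖v x i‖ ^ 4| ≤ 1 := fun v hv i => by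
    rw [abs_of_nonneg (by positivity)]
    exact pow_le_one₀ (norm_nonneg _) ((PiLp.norm_apply_le (v x) i).trans
      ((lp.norm_apply_le_norm (by norm_num) v x).trans hv))
  rw [nonlinearity_apply_eq hCN, nonlinearity_apply_eq hCN]
  set p := u x
  set q := w x
  set A := CNtilde (‖p 0‖ ^ 4) (‖p 1‖ ^ 4)
  set B := CNtilde (‖q 0‖ ^ 4) (‖q 1‖ ^ 4) with hB
  have e : (act A p - act 1 p) - (act B q - act 1 q)
      = (act A p - act B p) + (act B (p - q) - act 1 (p - q)) := by
    have hs : ∀ C : U2, act C (p - q) = act C p - act C q := fun C => by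
      rw [eq_sub_iff_add_eq, ← act_add, sub_add_cancel]
    rw [hs, hs]
    abel
  rw [e]
  have h1 : ‖act A p - act B p‖ ≤ L * (‖p - q‖ * (‖p‖ + ‖q‖) ^ 3 + ‖p - q‖ * (‖p‖ + ‖q‖) ^ 3)
      * (‖p‖ + ‖q‖) := by
    refine (norm_act_sub_le _ _ _).trans ?_
    refine mul_le_mul ((hL _ _ _ _ (hle u hu 0) (hle u hu 1) (hle w hw 0) (hle w hw 1)).trans ?_)
      (le_add_of_nonneg_right (norm_nonneg _)) (norm_nonneg _) (by positivity)
    exact mul_le_mul_of_nonneg_left (add_le_add (abs_norm_pow_four_sub_le _ _ _)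
      (abs_norm_pow_four_sub_le _ _ _)) hL0
  have h2 : ‖act B (p - q) - act 1 (p - q)‖ ≤ K * (‖p‖ + ‖q‖) ^ 4 * ‖p - q‖ := by
    refine (norm_act_sub_le _ _ _).trans ?_
    refine mul_le_mul_of_nonneg_right ((norm_coin_sub_one_le hK hA q).trans ?_) (norm_nonneg _)
    gcongr
    exact le_add_of_nonneg_left (norm_nonneg _)
  refine (norm_add_le _ _).trans ((add_le_add h1 h2).trans_eq ?_)
  ring

theorem l1_nonlinearity_sub_le (u w : State) (hu : ‖u‖ ≤ 1) (hw : ‖w‖ ≤ 1) {m σ : ℝ}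
    (hm : 0 < m) (hσ : 0 < σ) :
    l1 (nonlinearity CN u - nonlinearity CN w : State) ≤
      ENNReal.ofReal ((2 * L + K) * (σ / m) ^ 4) * l5 (u - w : State) +
      ENNReal.ofReal ((2 * L + K) * (16 * (m / σ))) * (l5 u + l5 w) := by
  simp only [l1, l5]
  rw [← ENNReal.tsum_add, ← ENNReal.tsum_mul_left, ← ENNReal.tsum_mul_left, ← ENNReal.tsum_add]
  refine ENNReal.tsum_le_tsum fun x => ?_
  rw [lp.coeFn_sub, lp.coeFn_sub, Pi.sub_apply, Pi.sub_apply]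
  simp only [← ofReal_norm]
  rw [← ENNReal.ofReal_pow (norm_nonneg _), ← ENNReal.ofReal_pow (norm_nonneg _),
    ← ENNReal.ofReal_pow (norm_nonneg _), ← ENNReal.ofReal_add (by positivity) (by positivity),
    ← ENNReal.ofReal_mul (by positivity), ← ENNReal.ofReal_mul (by positivity),
    ← ENNReal.ofReal_add (by positivity) (by positivity)]
  refine ENNReal.ofReal_le_ofReal ?_
  refine (norm_nonlinearity_sub_apply_le hCN hK hA hL0 hL u w hu hw x).trans ?_
  rw [mul_assoc, mul_assoc, ← mul_add]
  refine mul_le_mul_of_nonneg_left ?_ (by positivity)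
  refine (mul_pow_four_le (norm_nonneg _) (by positivity) hm hσ).trans ?_
  refine add_le_add le_rfl ?_
  rw [mul_comm 16, mul_assoc]
  refine mul_le_mul_of_nonneg_left ?_ (by positivity)
  exact (add_pow_le (norm_nonneg _) (norm_nonneg _) 5).trans_eq (by norm_num)

/-- A bootstrap that is linear in the size `m` of the initial difference: sources of total size at
most `m` keep the difference of size `2m`, and this returns sources smaller by a factor `σ⁴`. The
constant is `1056 = 2⁵ + 16 · (32 + 32)`. -/
theorem sum_nonlinearity_sub_le {C₀ : U2} {A : ℝ} (hA0 : 0 ≤ A)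
    (H : ∀ d f : ℕ → State, (∀ t, d (t + 1) = linearWalk C₀ (d t + f t)) →
      ∀ T : ℕ, ∑ t ∈ Finset.range (T + 1), l5 (d t) ≤
        ENNReal.ofReal A * (l1 (d 0) + ∑ s ∈ Finset.range T, l1 (f s)) ^ 5)
    {v w : ℕ → State} (hv : ∀ t, ‖v t‖ ≤ 1) (hw : ∀ t, ‖w t‖ ≤ 1)
    (hd : ∀ t, v (t + 1) - w (t + 1) = linearWalk C₀ ((v t - w t) +
      (nonlinearity CN (v t) - nonlinearity CN (w t)))) {m σ : ℝ} (hm : 0 < m) (hσ : 0 < σ)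
    (h0 : l1 (v 0 - w 0 : State) ≤ ENNReal.ofReal m)
    (hv5 : ∀ T, ∑ t ∈ Finset.range T, l5 (v t) ≤ ENNReal.ofReal (32 * A * σ ^ 5))
    (hw5 : ∀ T, ∑ t ∈ Finset.range T, l5 (w t) ≤ ENNReal.ofReal (32 * A * σ ^ 5))
    (hsmall : 1056 * (2 * L + K) * A * σ ^ 4 ≤ 1) (T : ℕ) :
    ∑ s ∈ Finset.range T, l1 (nonlinearity CN (v s) - nonlinearity CN (w s) : State) ≤
      ENNReal.ofReal (1056 * (2 * L + K) * A * σ ^ 4 * m) := by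
  induction T with
  | zero => simp
  | succ T ih =>
    have ih' := ih.trans (ENNReal.ofReal_le_ofReal (mul_le_of_le_one_left hm.le hsmall))
    have h5 : ∑ t ∈ Finset.range (T + 1), l5 (v t - w t : State) ≤
        ENNReal.ofReal (A * (2 * m) ^ 5) := by
      refine (H (fun t => v t - w t) (fun t => nonlinearity CN (v t) - nonlinearity CN (w t))
        hd T).trans ?_
      rw [ENNReal.ofReal_mul hA0, ENNReal.ofReal_pow (by positivity), two_mul,
        ENNReal.ofReal_add hm.le hm.le]
      exact mul_le_mul_right (pow_le_pow_left' (add_le_add h0 ih') 5) _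
    refine (Finset.sum_le_sum fun s _ =>
      l1_nonlinearity_sub_le hCN hK hA hL0 hL _ _ (hv s) (hw s) hm hσ).trans ?_
    rw [Finset.sum_add_distrib, ← Finset.mul_sum, ← Finset.mul_sum, Finset.sum_add_distrib]
    refine (add_le_add (mul_le_mul_right h5 _)
      (mul_le_mul_right (add_le_add (hv5 _) (hw5 _)) _)).trans ?_
    rw [← ENNReal.ofReal_add (by positivity) (by positivity), ← ENNReal.ofReal_mul (by positivity),
      ← ENNReal.ofReal_mul (by positivity), ← ENNReal.ofReal_add (by positivity) (by positivity)]
    refine ENNReal.ofReal_le_ofReal (le_of_eq ?_)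
    field_simp
    ring

/-- The two flows start `U₀ N(φ)` apart, of `ℓ¹` size at most `m = 2 K σ⁵`, and their accumulated
sources differ by a constant times `σ⁴ m`. The factor `2` in the smallness of `φ` allows for the
growth of `ℓ¹` under one free step. -/
theorem norm_Wstar_commutator_sub_le {C₀ : U2} {A : ℝ} (hA0 : 0 ≤ A) (hKpos : 0 < K)
    (H : ∀ d f : ℕ → State, (∀ t, d (t + 1) = linearWalk C₀ (d t + f t)) →
      ∀ T : ℕ, ∑ t ∈ Finset.range (T + 1), l5 (d t) ≤
        ENNReal.ofReal A * (l1 (d 0) + ∑ s ∈ Finset.range T, l1 (f s)) ^ 5)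
    {σ : ℝ} (hσ : 0 < σ) (hσ1 : σ ≤ 1) (hs1 : 32 * K * A * σ ^ 4 ≤ 1)
    (hs2 : 1056 * (2 * L + K) * A * σ ^ 4 ≤ 1) {φ : State} (hφ : 2 * l1 φ ≤ ENNReal.ofReal σ) :
    ‖Wstar C₀ CN φ - (linearWalk C₀).symm (Wstar C₀ CN (linearWalk C₀ φ)) - nonlinearity CN φ‖ ≤
      1056 * (2 * L + K) * A * σ ^ 4 * (2 * K * σ ^ 5) := by
  have hφ2 : l1 (linearWalk C₀ φ) ≤ ENNReal.ofReal σ := (l1_linearWalk_le C₀ φ).trans hφ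
  have hφ1 : l1 φ ≤ ENNReal.ofReal σ := le_trans (by rw [two_mul]; exact le_self_add) hφ
  have hs1' : 32 * ENNReal.ofReal K * ENNReal.ofReal A * ENNReal.ofReal σ ^ 4 ≤ 1 := by
    rw [← ENNReal.ofReal_pow hσ.le, show (32 : ENNReal) = ENNReal.ofReal 32 by norm_num,
      ← ENNReal.ofReal_mul (by positivity), ← ENNReal.ofReal_mul (by positivity),
      ← ENNReal.ofReal_mul (by positivity)]
    exact ENNReal.ofReal_le_one.2 hs1
  have e32 : 32 * ENNReal.ofReal A * ENNReal.ofReal σ ^ 5 = ENNReal.ofReal (32 * A * σ ^ 5) := by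
    rw [← ENNReal.ofReal_pow hσ.le, show (32 : ENNReal) = ENNReal.ofReal 32 by norm_num,
      ← ENNReal.ofReal_mul (by positivity), ← ENNReal.ofReal_mul (by positivity)]
  have b1 := sum_nonlinearity_le hCN hK hA H hφ1 hs1'
  have b2 := sum_nonlinearity_le hCN hK hA H hφ2 hs1'
  rw [e32] at b1 b2
  have hnorm : ∀ ψ : State, l1 ψ ≤ ENNReal.ofReal σ → ‖ψ‖ ≤ 1 := fun ψ hψ => by
    have := (enorm_le_l1 ψ).trans hψ
    rw [← ofReal_norm] at this
    exact ((ENNReal.ofReal_le_ofReal_iff hσ.le).1 this).trans hσ1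
  set v : ℕ → State := fun t => evolution (fun s₁ s₂ => C₀ * CN s₁ s₂) (t + 1) φ with hv
  set w : ℕ → State := fun t => evolution (fun s₁ s₂ => C₀ * CN s₁ s₂) t (linearWalk C₀ φ) with hw
  have h0 : v 0 - w 0 = linearWalk C₀ (nonlinearity CN φ) := by
    have e0 : v 0 = linearWalk C₀ (φ + nonlinearity CN φ) := evolution_succ C₀ CN φ 0
    have e1 : w 0 = linearWalk C₀ φ := rfl
    rw [e0, e1, map_add, add_sub_cancel_left]
  have hm : l1 (v 0 - w 0 : State) ≤ ENNReal.ofReal (2 * K * σ ^ 5) := by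
    rw [h0]
    refine (l1_linearWalk_le _ _).trans ((mul_le_mul_right (l1_nonlinearity_le hCN hK hA φ) _).trans
      ((mul_le_mul_right (mul_le_mul_right ((l5_le _).trans (pow_le_pow_left' hφ1 5)) _) _).trans_eq
      ?_))
    rw [← ENNReal.ofReal_pow hσ.le, ← ENNReal.ofReal_mul hK,
      show (2 : ENNReal) = ENNReal.ofReal 2 by norm_num, ← ENNReal.ofReal_mul (by norm_num),
      mul_assoc]
  have hsum := sum_nonlinearity_sub_le hCN hK hA hL0 hL hA0 H (v := v) (w := w)
    (fun t => by rw [hv, norm_evolution]; exact hnorm φ hφ1)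
    (fun t => by rw [hw, norm_evolution]; exact hnorm _ hφ2)
    (fun t => by
      simp only [hv, hw]
      rw [evolution_succ C₀ CN φ (t + 1), evolution_succ C₀ CN (linearWalk C₀ φ) t, ← map_sub]
      congr 1
      abel) (by positivity : 0 < 2 * K * σ ^ 5) hσ hm
    (fun T => by
      refine le_trans ?_ (b1 (T + 1)).2
      rw [Finset.sum_range_succ']
      exact le_self_add)
    (fun T => (b2 T).2) hs2
  have hfin := enorm_Wstar_commutator_sub_le
    (existsUnique_isFinalData ENNReal.ofReal_ne_top fun T => (b1 T).1).exists
    (existsUnique_isFinalData ENNReal.ofReal_ne_top fun T => (b2 T).1).exists hsum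
  rw [← ofReal_norm] at hfin
  exact (ENNReal.ofReal_le_ofReal_iff (by positivity)).1 hfin

end

/-! ### Taylor expansion of the coin and extraction of the derivative. -/

theorem exists_norm_sub_taylor_le {E : Type*} [NormedAddCommGroup E] [NormedSpace ℝ E] {f : ℝ → E}
    (hf : ContDiff ℝ 2 f) : ∃ M : ℝ, 0 ≤ M ∧ ∀ s ∈ Set.Icc (0 : ℝ) 1,
      ‖f s - f 0 - s • deriv f 0‖ ≤ M * s ^ 2 := by
  obtain ⟨C, hC⟩ := exists_taylor_mean_remainder_bound (n := 1) (zero_le_one' ℝ)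
    (hf.contDiffOn (s := Set.Icc (0 : ℝ) 1))
  refine ⟨|C|, abs_nonneg C, fun s hs => ?_⟩
  have h := hC s hs
  rw [taylorWithinEval_succ, taylor_within_zero_eval, zero_add, iteratedDerivWithin_one,
    (hf.differentiable (by norm_num) 0).derivWithin
      (uniqueDiffOn_Icc zero_lt_one 0 (by norm_num))] at h
  simp only [CharP.cast_eq_zero, zero_add, Nat.factorial_zero, Nat.cast_one, mul_one, inv_one,
    sub_zero, pow_one, one_mul, Nat.reduceAdd] at h
  rw [sub_sub]
  exact h.trans (mul_le_mul_of_nonneg_right (le_abs_self C) (sq_nonneg s))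

theorem norm_entry_le (M : Matrix (Fin 2) (Fin 2) ℂ) (i j : Fin 2) : ‖M i j‖ ≤ ‖M‖ := by
  have h := Matrix.l2_opNorm_mulVec M (EuclideanSpace.single j (1 : ℂ))
  rw [PiLp.norm_single, norm_one, mul_one] at h
  refine le_trans (le_of_eq ?_) ((PiLp.norm_apply_le _ i).trans h)
  simp

theorem exists_norm_le_of_entries : ∃ c : ℝ, 0 ≤ c ∧ ∀ (M : Matrix (Fin 2) (Fin 2) ℂ) (ε : ℝ),
    (∀ i j, ‖M i j‖ ≤ ε) → ‖M‖ ≤ c * ε := by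
  refine ⟨∑ i, ∑ j, ‖(Matrix.single i j (1 : ℂ) : Matrix (Fin 2) (Fin 2) ℂ)‖,
    Finset.sum_nonneg fun i _ => Finset.sum_nonneg fun j _ => norm_nonneg _, fun M ε hM => ?_⟩
  calc ‖M‖ = ‖∑ i, ∑ j, M i j • (Matrix.single i j (1 : ℂ) : Matrix (Fin 2) (Fin 2) ℂ)‖ := by
        congr 1
        simp only [Matrix.smul_single, smul_eq_mul, mul_one]
        exact Matrix.matrix_eq_sum_single M
    _ ≤ ∑ i, ∑ j, ‖(Matrix.single i j (1 : ℂ) : Matrix (Fin 2) (Fin 2) ℂ)‖ * ε := by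
        refine (norm_sum_le _ _).trans (Finset.sum_le_sum fun i _ => (norm_sum_le _ _).trans
          (Finset.sum_le_sum fun j _ => ?_))
        rw [norm_smul, mul_comm]
        exact mul_le_mul_of_nonneg_left (hM i j) (norm_nonneg _)
    _ = _ := by simp only [Finset.sum_mul]

/-- Both combinations are exact on affine functions: `2 g(λ) - g(2λ)` returns `p` and the quotient
returns `q`. The errors are at most `(2 + 16) C λ⁴` and `(16 + 1) C λ⁴ / λ`. -/
theorem norm_diffQuot_sub_le {g : ℝ → ℂ} {p q : ℂ} {C ρ : ℝ} (hC : 0 ≤ C)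
    (hg : ∀ μ : ℝ, 0 < μ → μ < ρ → ‖g μ - (p + μ * q)‖ ≤ C * μ ^ 4) {lam : ℝ} (hlam : 0 < lam)
    (hlam1 : lam ≤ 1) (hlam2 : 2 * lam < ρ) :
    ‖g lam - lam * diffQuot g lam - p‖ ≤ 18 * C * lam ^ 3 ∧
      ‖diffQuot g lam - q‖ ≤ 18 * C * lam ^ 3 := by
  have h1 := hg lam hlam (by linarith)
  have h2 := hg (2 * lam) (by linarith) hlam2
  have hl : (lam : ℂ) ≠ 0 := by exact_mod_cast hlam.ne'
  push_cast at h2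
  have e1 : g lam - lam * diffQuot g lam - p
      = (2 : ℂ) * (g lam - (p + lam * q)) - (g (2 * lam) - (p + 2 * lam * q)) := by
    rw [diffQuot]; field_simp; ring
  have e2 : diffQuot g lam - q
      = (lam : ℂ)⁻¹ * ((g (2 * lam) - (p + 2 * lam * q)) - (g lam - (p + lam * q))) := by
    rw [diffQuot]; field_simp; ring
  have hp : 0 ≤ C * lam ^ 3 := by positivity
  constructor
  · rw [e1]
    refine (norm_sub_le _ _).trans ?_
    rw [norm_mul, Complex.norm_ofNat]
    have : C * lam ^ 3 * lam ≤ C * lam ^ 3 * 1 := mul_le_mul_of_nonneg_left hlam1 hp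
    nlinarith
  · rw [e2, norm_mul, norm_inv, Complex.norm_real, Real.norm_of_nonneg hlam.le,
      inv_mul_le_iff₀ hlam]
    refine (norm_sub_le _ _).trans ((add_le_add h2 h1).trans ?_)
    have : 0 ≤ C * lam ^ 4 := by positivity
    nlinarith

/-- The state `α δ_{1,0} + β δ_{2,0}`. -/
theorem pointState_apply (α β : ℂ) (x : ℤ) :
    (α • delta 0 + β • delta 1 : State) x = if x = 0 then !₂[α, β] else 0 := by
  rw [lp.coeFn_add, Pi.add_apply, lp.coeFn_smul, lp.coeFn_smul, Pi.smul_apply, Pi.smul_apply, delta,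
    delta, lp.single_apply, lp.single_apply]
  split_ifs with h
  · subst h
    rw [Pi.single_eq_same, Pi.single_eq_same]
    ext i
    fin_cases i <;> simp
  · rw [Pi.single_eq_of_ne h, Pi.single_eq_of_ne h]
    simp

theorem l1_pointState_le {α β : ℝ} (hα : 0 ≤ α) (hβ : 0 ≤ β) :
    l1 ((α : ℂ) • delta 0 + (β : ℂ) • delta 1 : State) ≤ ENNReal.ofReal (α + β) := by
  rw [l1, tsum_eq_single 0 fun x hx => by rw [pointState_apply, if_neg hx, enorm_zero],
    pointState_apply, if_pos rfl, ← ofReal_norm]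
  refine ENNReal.ofReal_le_ofReal ((norm_spin_le _).trans (le_of_eq ?_))
  simp [abs_of_nonneg hα, abs_of_nonneg hβ]

theorem inner_delta (j : Fin 2) (ψ : State) : inner ℂ (delta j) ψ = ψ 0 j := by
  rw [delta, lp.inner_single_left, EuclideanSpace.inner_single_left]
  simp

theorem nonlinearity_pointState {CN CNtilde : ℝ → ℝ → U2}
    (hCN : ∀ s₁ s₂ : ℝ, 0 ≤ s₁ → 0 ≤ s₂ → CN s₁ s₂ = CNtilde (s₁ ^ 2) (s₂ ^ 2)) {α β : ℝ}
    (hα : 0 ≤ α) (hβ : 0 ≤ β) (j : Fin 2) :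
    nonlinearity CN ((α : ℂ) • delta 0 + (β : ℂ) • delta 1 : State) 0 j =
      ((CNtilde (α ^ 4) (β ^ 4) : Matrix (Fin 2) (Fin 2) ℂ) - 1) j 0 * α +
        ((CNtilde (α ^ 4) (β ^ 4) : Matrix (Fin 2) (Fin 2) ℂ) - 1) j 1 * β := by
  rw [nonlinearity_apply_eq hCN, pointState_apply, if_pos rfl]
  have e0 : ‖(!₂[(α : ℂ), (β : ℂ)] : Spin) 0‖ = α := by simp [abs_of_nonneg hα]
  have e1 : ‖(!₂[(α : ℂ), (β : ℂ)] : Spin) 1‖ = β := by simp [abs_of_nonneg hβ]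
  rw [e0, e1, act_one]
  fin_cases j <;> simp [act, Matrix.sub_apply] <;> ring

/-- Leading order of the scattering coefficients, provided the commutator estimate. -/
theorem norm_scatCoeff_sub_le {C₀ : U2} {CN CNtilde : ℝ → ℝ → U2}
    (hCN : ∀ s₁ s₂ : ℝ, 0 ≤ s₁ → 0 ≤ s₂ → CN s₁ s₂ = CNtilde (s₁ ^ 2) (s₂ ^ 2)) {B σ₀ : ℝ}
    (hW : ∀ σ : ℝ, 0 < σ → σ ≤ σ₀ → ∀ φ : State, 2 * l1 φ ≤ ENNReal.ofReal σ →
      ‖Wstar C₀ CN φ - (linearWalk C₀).symm (Wstar C₀ CN (linearWalk C₀ φ)) - nonlinearity CN φ‖ ≤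
        B * σ ^ 9) (hB : 0 ≤ B) {μ : ℝ} (hμ : 0 < μ) (hμ1 : μ ≤ 1) (hμσ : 4 * μ ^ 2 ≤ σ₀) {α β : ℝ}
    (hα : 0 ≤ α) (hβ : 0 ≤ β) (hα' : α ≤ μ ^ 2) (hβ' : β ≤ μ ^ 2) (j : Fin 2) {p q : ℂ} {R : ℝ}
    (hR : ‖((CNtilde (α ^ 4) (β ^ 4) : Matrix (Fin 2) (Fin 2) ℂ) - 1) j 0 * α +
        ((CNtilde (α ^ 4) (β ^ 4) : Matrix (Fin 2) (Fin 2) ℂ) - 1) j 1 * β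
        - μ ^ 10 * (p + μ * q)‖ ≤ R * μ ^ 14) :
    ‖scatCoeff C₀ CN j μ ((α : ℂ) • delta 0 + (β : ℂ) • delta 1) - (p + μ * q)‖ ≤
      (R + B * 4 ^ 9) * μ ^ 4 := by
  set φ : State := (α : ℂ) • delta 0 + (β : ℂ) • delta 1 with hφ
  have hl : 2 * l1 φ ≤ ENNReal.ofReal (4 * μ ^ 2) := by
    refine (mul_le_mul_right (l1_pointState_le hα hβ) 2).trans ?_
    rw [show (2 : ENNReal) = ENNReal.ofReal 2 by norm_num, ← ENNReal.ofReal_mul (by norm_num)]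
    exact ENNReal.ofReal_le_ofReal (by linarith)
  -- The point state has `ℓ¹` norm at most `2 μ²`, so `σ = 4 μ²` is admissible. The error `σ⁹` is of
  -- order `μ¹⁸`, more than the required `μ¹⁴`.
  have hw := hW (4 * μ ^ 2) (by positivity) hμσ φ hl
  set ψ := Wstar C₀ CN φ - (linearWalk C₀).symm (Wstar C₀ CN (linearWalk C₀ φ)) with hψ
  have hj : ‖ψ 0 j - nonlinearity CN φ 0 j‖ ≤ B * (4 * μ ^ 2) ^ 9 :=
    ((PiLp.norm_apply_le ((ψ - nonlinearity CN φ : State) 0) j).trans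
      (lp.norm_apply_le_norm (by norm_num) _ 0)).trans hw
  rw [hφ, nonlinearity_pointState hCN hα hβ] at hj
  have hμc : (μ : ℂ) ≠ 0 := by exact_mod_cast hμ.ne'
  rw [scatCoeff, inner_delta, ← hψ]
  have e : ((μ : ℂ) ^ 10)⁻¹ * ψ 0 j - (p + μ * q) =
      ((μ : ℂ) ^ 10)⁻¹ * (ψ 0 j - μ ^ 10 * (p + μ * q)) := by field_simp
  rw [e, norm_mul, norm_inv, norm_pow, Complex.norm_real, Real.norm_of_nonneg hμ.le,
    inv_mul_le_iff₀ (by positivity)]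
  have h18 : B * (4 * μ ^ 2) ^ 9 ≤ B * 4 ^ 9 * μ ^ 14 := by
    rw [mul_pow, ← pow_mul, mul_assoc]
    gcongr B * (4 ^ 9 * ?_)
    exact pow_le_pow_of_le_one hμ.le hμ1 (by norm_num)
  refine (norm_sub_le_norm_sub_add_norm_sub _ _ _).trans
    ((add_le_add (hj.trans h18) hR).trans_eq ?_)
  ring

/-- Second order Taylor along the first axis, but only the Lipschitz bound in the second variable:
for `s = μ⁸` and `t = μ¹²` the error `μ¹²` is already small enough. -/
theorem exists_norm_coin_expansion_le {F : ℝ → ℝ → U2}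
    (hF : ContDiff ℝ 2 fun p : ℝ × ℝ => (F p.1 p.2 : Matrix (Fin 2) (Fin 2) ℂ))
    (hF0 : (F 0 0 : Matrix (Fin 2) (Fin 2) ℂ) = 1) :
    ∃ M : ℝ, 0 ≤ M ∧ ∀ s ∈ Set.Icc (0 : ℝ) 1, ∀ t ∈ Set.Icc (0 : ℝ) 1,
      ‖(F s t : Matrix (Fin 2) (Fin 2) ℂ) - 1 -
        s • deriv (fun s : ℝ => (F s 0 : Matrix (Fin 2) (Fin 2) ℂ)) 0‖ ≤ M * (s ^ 2 + t) := by
  obtain ⟨L, hL0, hL⟩ := exists_lipschitz_coin hF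
  have hf : ContDiff ℝ 2 fun s : ℝ => (F s 0 : Matrix (Fin 2) (Fin 2) ℂ) :=
    hF.comp (f := fun s : ℝ => (s, (0 : ℝ))) (by fun_prop)
  obtain ⟨M, hM0, hM⟩ := exists_norm_sub_taylor_le hf
  refine ⟨M + L, by positivity, fun s hs t ht => ?_⟩
  have h1 := hM s hs
  have hs1 : |s| ≤ 1 := by rw [abs_of_nonneg hs.1]; exact hs.2
  have ht1 : |t| ≤ 1 := by rw [abs_of_nonneg ht.1]; exact ht.2
  have h2 := hL s t s 0 hs1 ht1 hs1 (by simp)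
  rw [sub_self, abs_zero, zero_add, sub_zero, abs_of_nonneg ht.1] at h2
  rw [hF0] at h1
  have e : (F s t : Matrix (Fin 2) (Fin 2) ℂ) - 1 -
        s • deriv (fun s : ℝ => (F s 0 : Matrix (Fin 2) (Fin 2) ℂ)) 0
      = ((F s t : Matrix (Fin 2) (Fin 2) ℂ) - F s 0) + ((F s 0 : Matrix (Fin 2) (Fin 2) ℂ) - 1 -
        s • deriv (fun s : ℝ => (F s 0 : Matrix (Fin 2) (Fin 2) ℂ)) 0) := by abel
  rw [e]
  refine (norm_add_le _ _).trans ((add_le_add h2 h1).trans ?_)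
  have := mul_nonneg hM0 ht.1
  have := mul_nonneg hL0 (sq_nonneg s)
  linarith

theorem norm_row_sub_le {E D : Matrix (Fin 2) (Fin 2) ℂ} {M μ : ℝ} (hμ : 0 < μ) (hμ1 : μ ≤ 1)
    (hM : 0 ≤ M) (hE : ‖E - (μ ^ 8 : ℝ) • D‖ ≤ M * ((μ ^ 8) ^ 2 + μ ^ 12)) {k l : Fin 2}
    (j : Fin 2) :
    ‖E j k * ((μ ^ 2 : ℝ) : ℂ) + E j l * ((μ ^ 3 : ℝ) : ℂ) - μ ^ 10 * (D j k + μ * D j l)‖ ≤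
      4 * M * μ ^ 14 := by
  have hij : ∀ i, ‖E j i - (μ : ℂ) ^ 8 * D j i‖ ≤ 2 * M * μ ^ 12 := fun i => by
    have h := (norm_entry_le (E - (μ ^ 8 : ℝ) • D) j i).trans hE
    rw [Matrix.sub_apply, Matrix.smul_apply, Complex.real_smul, Complex.ofReal_pow] at h
    refine h.trans ?_
    have : (μ ^ 8) ^ 2 ≤ μ ^ 12 := by
      rw [← pow_mul]; exact pow_le_pow_of_le_one hμ.le hμ1 (by norm_num)
    nlinarith
  have e : E j k * ((μ ^ 2 : ℝ) : ℂ) + E j l * ((μ ^ 3 : ℝ) : ℂ) - μ ^ 10 * (D j k + μ * D j l) =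
      (E j k - (μ : ℂ) ^ 8 * D j k) * ((μ ^ 2 : ℝ) : ℂ) +
        (E j l - (μ : ℂ) ^ 8 * D j l) * ((μ ^ 3 : ℝ) : ℂ) := by
    push_cast; ring
  rw [e]
  refine (norm_add_le _ _).trans ?_
  rw [norm_mul, norm_mul, Complex.norm_real, Complex.norm_real, Real.norm_of_nonneg (by positivity),
    Real.norm_of_nonneg (by positivity)]
  have h3 : μ ^ 3 ≤ μ ^ 2 := pow_le_pow_of_le_one hμ.le hμ1 (by norm_num)
  have a1 := mul_le_mul_of_nonneg_right (hij k) (by positivity : (0 : ℝ) ≤ μ ^ 2)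
  have a2 := mul_le_mul (hij l) h3 (by positivity) (by positivity)
  refine (add_le_add a1 a2).trans_eq ?_
  ring

/-- Small data scattering, together with the leading order of the commutator of `W*` with the
linear walk. -/
theorem exists_scattering {a b : ℂ} (ha₀ : 0 < ‖a‖) (ha₁ : ‖a‖ < 1) {C₀ : U2}
    (hC₀ : (C₀ : Matrix (Fin 2) (Fin 2) ℂ) = !![a, b; -conj b, conj a])
    {CN CNtilde : ℝ → ℝ → U2}
    (hCN : ∀ s₁ s₂ : ℝ, 0 ≤ s₁ → 0 ≤ s₂ → CN s₁ s₂ = CNtilde (s₁ ^ 2) (s₂ ^ 2))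
    (hC2 : ContDiff ℝ 2 fun p : ℝ × ℝ => (CNtilde p.1 p.2 : Matrix (Fin 2) (Fin 2) ℂ))
    (hA : ∃ K : ℝ, ∀ s₁ s₂ : ℝ,
      ‖(CNtilde s₁ s₂ : Matrix (Fin 2) (Fin 2) ℂ) - 1‖ ≤ K * (|s₁| + |s₂|)) :
    ∃ σ₀ B : ℝ, 0 < σ₀ ∧ 0 ≤ B ∧
      (∀ u₀ : State, l1 u₀ ≤ ENNReal.ofReal σ₀ → ∃! uplus : State, IsFinalData C₀ CN u₀ uplus) ∧
      ∀ σ : ℝ, 0 < σ → σ ≤ σ₀ → ∀ φ : State, 2 * l1 φ ≤ ENNReal.ofReal σ →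
      ‖Wstar C₀ CN φ - (linearWalk C₀).symm (Wstar C₀ CN (linearWalk C₀ φ)) - nonlinearity CN φ‖ ≤
        B * σ ^ 9 := by
  obtain ⟨K', hK'⟩ := hA
  -- The constant is made strictly positive because the comparison of flows divides by `m = 2 K σ⁵`.
  obtain ⟨K, hK, hA⟩ : ∃ K : ℝ, 0 < K ∧ ∀ s₁ s₂ : ℝ,
      ‖(CNtilde s₁ s₂ : Matrix (Fin 2) (Fin 2) ℂ) - 1‖ ≤ K * (|s₁| + |s₂|) :=
    ⟨|K'| + 1, by positivity, fun s₁ s₂ => (hK' s₁ s₂).trans (mul_le_mul_of_nonneg_right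
      ((le_abs_self K').trans (le_add_of_nonneg_right zero_le_one)) (by positivity))⟩
  obtain ⟨L, hL0, hL⟩ := exists_lipschitz_coin hC2
  obtain ⟨A', hA', H'⟩ := exists_spacetime_bound ha₀ ha₁ hC₀
  obtain ⟨A, hA0, rfl⟩ : ∃ A : ℝ, 0 ≤ A ∧ A' = ENNReal.ofReal A :=
    ⟨A'.toReal, ENNReal.toReal_nonneg, (ENNReal.ofReal_toReal hA').symm⟩
  -- For `σ ≤ Q⁻¹ ≤ 1` one has `σ⁴ ≤ σ`, so each smallness condition follows from `Q σ ≤ 1`.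
  set Q := 1 + 32 * K * A + 1056 * (2 * L + K) * A with hQ
  have n1 : 0 ≤ 32 * K * A := by positivity
  have n2 : 0 ≤ 1056 * (2 * L + K) * A := by positivity
  have hQ1 : 1 ≤ Q := by linarith
  have hσQ : ∀ {σ : ℝ}, 0 < σ → σ ≤ Q⁻¹ → σ ≤ 1 ∧ 32 * K * A * σ ^ 4 ≤ 1 ∧
      1056 * (2 * L + K) * A * σ ^ 4 ≤ 1 := fun {σ} h0 h => by
    have h1 : σ ≤ 1 := h.trans (inv_le_one_of_one_le₀ hQ1)
    have h2 : Q * σ ≤ 1 := by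
      have := mul_le_mul_of_nonneg_left h (by linarith : 0 ≤ Q)
      rwa [mul_inv_cancel₀ (by linarith)] at this
    have h4 : σ ^ 4 ≤ σ := pow_le_of_le_one h0.le h1 (by norm_num)
    have h5 : ∀ {c : ℝ}, 0 ≤ c → c ≤ Q → c * σ ^ 4 ≤ 1 := fun hc hcQ =>
      (mul_le_mul hcQ h4 (by positivity) (by linarith)).trans h2
    exact ⟨h1, h5 n1 (by linarith), h5 n2 (by linarith)⟩
  have hQ0 : 0 < Q⁻¹ := inv_pos.2 (by linarith)
  refine ⟨Q⁻¹, 1056 * (2 * L + K) * A * (2 * K), hQ0, by positivity, fun u₀ hu => ?_,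
    fun σ h0 h φ hφ => ?_⟩
  · have hs1 := (hσQ hQ0 le_rfl).2.1
    refine existsUnique_isFinalData ENNReal.ofReal_ne_top fun T =>
      (sum_nonlinearity_le hCN hK.le hA H' hu ?_ T).1
    rw [← ENNReal.ofReal_pow hQ0.le, show (32 : ENNReal) = ENNReal.ofReal 32 by norm_num,
      ← ENNReal.ofReal_mul (by positivity), ← ENNReal.ofReal_mul (by positivity),
      ← ENNReal.ofReal_mul (by positivity)]
    exact ENNReal.ofReal_le_one.2 hs1
  · obtain ⟨h1, hs1, hs2⟩ := hσQ h0 h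
    refine (norm_Wstar_commutator_sub_le hCN hK.le hA hL0 hL hA0 hK H' h0 h1 hs1 hs2 hφ).trans_eq ?_
    ring

end NLQW

end

theorem theorem1p2
    (a b : ℂ) (ha₀ : 0 < ‖a‖) (ha₁ : ‖a‖ < 1)
    (C₀ : NLQW.U2)
    (hC₀ : (C₀ : Matrix (Fin 2) (Fin 2) ℂ) = !![a, b; -conj b, conj a])
    (CN CNtilde : ℝ → ℝ → NLQW.U2)
    (hCN : ∀ s₁ s₂ : ℝ, 0 ≤ s₁ → 0 ≤ s₂ → CN s₁ s₂ = CNtilde (s₁ ^ 2) (s₂ ^ 2))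
    (hC2 : ContDiff ℝ 2 fun p : ℝ × ℝ => (CNtilde p.1 p.2 : Matrix (Fin 2) (Fin 2) ℂ))
    (hA : ∃ K : ℝ, ∀ s₁ s₂ : ℝ,
      ‖(CNtilde s₁ s₂ : Matrix (Fin 2) (Fin 2) ℂ) - 1‖ ≤ K * (|s₁| + |s₂|)) :
    (∃ δ : ℝ, 0 < δ ∧ ∀ u₀ : NLQW.State,
      Summable (fun x : ℤ => ‖u₀ x‖) → ∑' x : ℤ, ‖u₀ x‖ < δ →
        ∃! uplus : NLQW.State, NLQW.IsFinalData C₀ CN u₀ uplus) ∧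
    ∃ K lam₀ : ℝ, 0 < lam₀ ∧ ∀ lam : ℝ, 0 < lam → lam < lam₀ →
      ‖!![NLQW.L1 C₀ CN 0 lam - lam * NLQW.diffQuot (NLQW.L1 C₀ CN 0) lam,
            NLQW.diffQuot (NLQW.L1 C₀ CN 0) lam;
          NLQW.L1 C₀ CN 1 lam - lam * NLQW.diffQuot (NLQW.L1 C₀ CN 1) lam,
            NLQW.diffQuot (NLQW.L1 C₀ CN 1) lam]
        - deriv (fun s : ℝ => (CNtilde s 0 : Matrix (Fin 2) (Fin 2) ℂ)) 0‖ ≤ K * lam ^ 3 ∧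
      ‖!![NLQW.diffQuot (NLQW.L2 C₀ CN 0) lam,
            NLQW.L2 C₀ CN 0 lam - lam * NLQW.diffQuot (NLQW.L2 C₀ CN 0) lam;
          NLQW.diffQuot (NLQW.L2 C₀ CN 1) lam,
            NLQW.L2 C₀ CN 1 lam - lam * NLQW.diffQuot (NLQW.L2 C₀ CN 1) lam]
        - deriv (fun s : ℝ => (CNtilde 0 s : Matrix (Fin 2) (Fin 2) ℂ)) 0‖ ≤ K * lam ^ 3 := by
  obtain ⟨σ₀, B, hσ₀, hB, hex, hW⟩ := NLQW.exists_scattering ha₀ ha₁ hC₀ hCN hC2 hA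
  refine ⟨⟨σ₀, hσ₀, fun u₀ hs hu => hex u₀ ?_⟩, ?_⟩
  · have e : NLQW.l1 u₀ = ENNReal.ofReal (∑' x : ℤ, ‖u₀ x‖) := by
      rw [ENNReal.ofReal_tsum_of_nonneg (fun _ => norm_nonneg _) hs]
      simp only [NLQW.l1, ofReal_norm]
    rw [e]
    exact ENNReal.ofReal_le_ofReal hu.le
  have h00 : (CNtilde 0 0 : Matrix (Fin 2) (Fin 2) ℂ) = 1 := by
    obtain ⟨K, hK⟩ := hA
    have h := hK 0 0
    rw [abs_zero, add_zero, mul_zero] at h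
    exact sub_eq_zero.1 (norm_le_zero_iff.1 h)
  obtain ⟨M₁, hM₁, hexp₁⟩ := NLQW.exists_norm_coin_expansion_le hC2 h00
  -- The second derivative is handled by the same expansion with the two variables exchanged.
  have hC2' : ContDiff ℝ 2 fun p : ℝ × ℝ => (CNtilde p.2 p.1 : Matrix (Fin 2) (Fin 2) ℂ) :=
    hC2.comp (f := fun p : ℝ × ℝ => (p.2, p.1)) (by fun_prop)
  obtain ⟨M₂, hM₂, hexp₂⟩ :=
    NLQW.exists_norm_coin_expansion_le (F := fun s t => CNtilde t s) hC2' h00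
  set D₁ := deriv (fun s : ℝ => (CNtilde s 0 : Matrix (Fin 2) (Fin 2) ℂ)) 0
  set D₂ := deriv (fun s : ℝ => (CNtilde 0 s : Matrix (Fin 2) (Fin 2) ℂ)) 0
  obtain ⟨c, hc, hentry⟩ := NLQW.exists_norm_le_of_entries
  obtain ⟨ρ, hρ, hρ1, hρσ⟩ : ∃ ρ : ℝ, 0 < ρ ∧ ρ ≤ 1 ∧ 4 * ρ ≤ σ₀ :=
    ⟨min 1 (σ₀ / 4), by positivity, min_le_left _ _, by linarith [min_le_right 1 (σ₀ / 4)]⟩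
  have hsmall : ∀ μ : ℝ, 0 < μ → μ < ρ → μ ≤ 1 ∧ 4 * μ ^ 2 ≤ σ₀ := fun μ h0 h => by
    have h1 : μ ≤ 1 := h.le.trans hρ1
    refine ⟨h1, ?_⟩
    nlinarith
  have hIcc : ∀ μ : ℝ, 0 < μ → μ ≤ 1 → ∀ n : ℕ, μ ^ n ∈ Set.Icc (0 : ℝ) 1 := fun μ h0 h n =>
    ⟨by positivity, pow_le_one₀ h0.le h⟩
  have hL1 : ∀ j : Fin 2, ∀ μ : ℝ, 0 < μ → μ < ρ →
      ‖NLQW.L1 C₀ CN j μ - (D₁ j 0 + μ * D₁ j 1)‖ ≤ (4 * M₁ + B * 4 ^ 9) * μ ^ 4 := by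
    intro j μ h0 h
    obtain ⟨h1, h2⟩ := hsmall μ h0 h
    have hE := hexp₁ (μ ^ 8) (hIcc μ h0 h1 8) (μ ^ 12) (hIcc μ h0 h1 12)
    have hrow := NLQW.norm_row_sub_le h0 h1 hM₁ hE (k := 0) (l := 1) j
    have := NLQW.norm_scatCoeff_sub_le hCN hW hB h0 h1 h2 (α := μ ^ 2) (β := μ ^ 3)
      (by positivity) (by positivity) le_rfl (pow_le_pow_of_le_one h0.le h1 (by norm_num)) j
      (p := D₁ j 0) (q := D₁ j 1) (R := 4 * M₁) (by
        rw [← pow_mul, ← pow_mul]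
        exact hrow)
    rw [Complex.ofReal_pow, Complex.ofReal_pow] at this
    exact this
  -- The larger component now sits in the second slot, so the constant term is the second column and
  -- the linear term the first.
  have hL2 : ∀ j : Fin 2, ∀ μ : ℝ, 0 < μ → μ < ρ →
      ‖NLQW.L2 C₀ CN j μ - (D₂ j 1 + μ * D₂ j 0)‖ ≤ (4 * M₂ + B * 4 ^ 9) * μ ^ 4 := by
    intro j μ h0 h
    obtain ⟨h1, h2⟩ := hsmall μ h0 h
    have hE := hexp₂ (μ ^ 8) (hIcc μ h0 h1 8) (μ ^ 12) (hIcc μ h0 h1 12)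
    have hrow := NLQW.norm_row_sub_le h0 h1 hM₂ hE (k := 1) (l := 0) j
    have := NLQW.norm_scatCoeff_sub_le hCN hW hB h0 h1 h2 (α := μ ^ 3) (β := μ ^ 2)
      (by positivity) (by positivity) (pow_le_pow_of_le_one h0.le h1 (by norm_num)) le_rfl j
      (p := D₂ j 1) (q := D₂ j 0) (R := 4 * M₂) (by
        rw [← pow_mul, ← pow_mul, add_comm (_ * _)]
        exact hrow)
    rw [Complex.ofReal_pow, Complex.ofReal_pow] at this
    exact this
  set Γ := 4 * M₁ + 4 * M₂ + B * 4 ^ 9 with hΓ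
  have hΓ0 : 0 ≤ Γ := by positivity
  -- The range is halved because the difference quotient also samples at `2 λ`.
  refine ⟨c * (18 * Γ), ρ / 2, by positivity, fun lam h0 h => ?_⟩
  have hle : ∀ {M μ : ℝ}, 4 * M + B * 4 ^ 9 ≤ Γ → (4 * M + B * 4 ^ 9) * μ ^ 4 ≤ Γ * μ ^ 4 :=
    fun h => mul_le_mul_of_nonneg_right h (by positivity)
  have d1 := fun j => NLQW.norm_diffQuot_sub_le hΓ0
    (fun μ hμ hμρ => (hL1 j μ hμ hμρ).trans (hle (by linarith))) h0 (by linarith) (by linarith)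
  have d2 := fun j => NLQW.norm_diffQuot_sub_le hΓ0
    (fun μ hμ hμρ => (hL2 j μ hμ hμρ).trans (hle (by linarith))) h0 (by linarith) (by linarith)
  rw [mul_assoc]
  constructor
  · refine hentry _ _ fun i j => ?_
    rw [Matrix.sub_apply]
    fin_cases i <;> fin_cases j
    exacts [(d1 0).1, (d1 0).2, (d1 1).1, (d1 1).2]
  · refine hentry _ _ fun i j => ?_
    rw [Matrix.sub_apply]
    fin_cases i <;> fin_cases j
    exacts [(d2 0).2, (d2 0).1, (d2 1).2, (d2 1).1]
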